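/- \textbf{Setting.} Let $m\ge 1$. For each $N\ge 1$ let $M_N(\mathbb C)_{sa}^m$ be the real inner product space of $m$-tuples of self-adjoint $N\times N$ matrices with $\langle x,y\rangle=\sum_j\operatorname{Tr}(x_jy_j)$, with its Lebesgue measure $dx$ (also written $\mathrm{vol}$). Put $\tau_N=\frac1N\operatorname{Tr}$ and $\|x\|_\infty=\max_j\|x_j\|$ (operator norm). A \emph{non-commutative law} is a linear, unital, completely positive, tracial functional on $\mathbb C\langle X_1,\dots,X_m\rangle$; the space $\Sigma_m$ of laws carries the topology of pointwise convergence, and $\lambda_x(p)=\tau_N(p(x))$ for $x\in M_N(\mathbb C)_{sa}^m$. A tracial von Neumann algebra $(\mathcal M,\tau)$ is a von Neumann algebra of operators on a Hilbert space with a bounded, weak-operator continuous linear functional $\tau$ such that $\tau(1)=1$, $\tau(xy)=\tau(yx)$, $\tau(x^*x)\ge 0$. A \emph{scalar-valued trace polynomial} is an element $f$ of the symmetric algebra of $\mathbb C\langle X_1,\dots,X_m\rangle/\mathrm{span}\{pq-qp\}$, the class of $p$ being written $\tau(p)$; $f(x)$ is obtained by replacing $\tau$ by $\tau_N$ and $X$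 by $x$. Functions $\phi_N:M_N(\mathbb C)_{sa}^m\to\mathbb C$ are \emph{asymptotically approximable by scalar-valued trace polynomials} if for all $\epsilon,R>0$ there is such an $f$ with $\limsup_{N\to\infty}\sup_{\|x\|_\infty\le R}|\phi_N(x)-f(x)|\le\epsilon$. For $\mathcal U\subseteq\Sigma_m$ let $\Gamma_N(\mathcal U)=\{x\in M_N(\mathbb C)_{sa}^m:\lambda_x\in\mathcal U\}$ and $\Gamma_{N,R}(\mathcal U)=\{x\in\Gamma_N(\mathcal U):\|x\|_\infty\le R\}$. With $\mathcal U$ ranging over the open neighborhoods of $\lambda$ in $\Sigma_m$ and $\log 0=-\infty$, let \[\chi_R(\lambda)=\inf_{\mathcal U\ni\lambda}\limsup_{N\to\infty}\Bigl(\tfrac1{N^2}\log\operatorname{vol}\Gamma_{N,R}(\mathcal U)+\tfrac m2\log N\Bigr),\qquad \chi(\lambda)=\sup_{R>0}\chi_R(\lambda),\] and let $\underline\chi_R(\lambda)$ and $\underline\chi(\lambda)=\sup_{R>0}\underline\chi_R(\lambda)$ be defined in the same way with $\liminf$ in place of $\limsup$. For a measure $d\mu=\rho\,dx$ let $h(\mu)=\int-\rho\log\rho\,dx$.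 \textbf{Proposition.} For $N\ge1$ let $V_N:M_N(\mathbb C)_{sa}^m\to\mathbb R$ be measurable with $Z_N=\int\exp(-N^2V_N(x))\,dx<\infty$, and let $d\mu_N=Z_N^{-1}\exp(-N^2V_N(x))\,dx$. Assume: (A) $\{\mu_N\}$ concentrates around a non-commutative law $\lambda$, i.e. $\lim_{N\to\infty}\mu_N(\Gamma_N(\mathcal U))=1$ for every neighborhood $\mathcal U$ of $\lambda$ in $\Sigma_m$. (B) $\{V_N\}$ is asymptotically approximable by scalar-valued trace polynomials. (C) For some integer $n\ge1$ and $a,b>0$, $|V_N(x)|\le a+b\sum_{j=1}^m\tau_N(x_j^{2n})$ for all $N$ and $x$. (D) There is $R_0>0$ such that, with the same $n$, $\displaystyle\lim_{N\to\infty}\int_{\|x\|_\infty\ge R_0}\Bigl(1+\sum_{j=1}^m\tau_N(x_j^{2n})\Bigr)d\mu_N(x)=0$. Then $\lambda$ is the law $p\mapsto\tau(p(X))$ of an $m$-tuple $X=(X_1,\dots,X_m)$ of self-adjoint elements of a tracial von Neumann algebra $(\mathcal M,\tau)$ with $\|X_j\|\le R_0$ for all $j$. Moreover, the integral defining $h(\mu_N)$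 converges absolutely for all sufficiently large $N$, and \[\chi(\lambda)=\chi_{R_0}(\lambda)=\limsup_{N\to\infty}\Bigl(\tfrac1{N^2}h(\mu_N)+\tfrac m2\log N\Bigr),\] \[\underline\chi(\lambda)=\underline\chi_{R_0}(\lambda)=\liminf_{N\to\infty}\Bigl(\tfrac1{N^2}h(\mu_N)+\tfrac m2\log N\Bigr).\] -/

import Mathlib

open Filter Topology MeasureTheory
open scoped ENNReal ComplexOrder Matrix

noncomputable section

namespace FreeEntropy

/-! ### Non-commutative polynomials and laws -/

/-- The algebra `ℂ⟨X₁, …, X_m⟩` of non-commutative polynomials, as the algebra of finite formal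
`ℂ`-linear combinations of words in the letters `0, …, m - 1`. -/
abbrev NCPoly (m : ℕ) : Type := MonoidAlgebra ℂ (FreeMonoid (Fin m))

/-- The conjugate-linear involution of `ℂ⟨X₁, …, X_m⟩` which reverses words and fixes each
variable. -/
def ncStar {m : ℕ} (p : NCPoly m) : NCPoly m :=
  p.coeff.sum fun w c => MonoidAlgebra.single w.reverse (star c)

/-- The conjugate transpose of a matrix of non-commutative polynomials. -/
def ncAdjoint {m k n : ℕ} (P : Matrix (Fin k) (Fin n) (NCPoly m)) :
    Matrix (Fin n) (Fin k) (NCPoly m) :=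
  Matrix.of fun i j => ncStar (P j i)

/-- Substitution of `x = (x₁, …, x_m)` for the variables of a non-commutative polynomial. -/
def ncEval {m : ℕ} {A : Type*} [Ring A] [Algebra ℂ A] (x : Fin m → A) : NCPoly m →ₐ[ℂ] A :=
  MonoidAlgebra.lift ℂ A (FreeMonoid (Fin m)) (FreeMonoid.lift x)

/-- Non-commutative laws of `m`-tuples: unital, completely positive, tracial linear functionals
on `ℂ⟨X₁, …, X_m⟩`. -/
structure NCLaw (m : ℕ) where
  toLinearMap : NCPoly m →ₗ[ℂ] ℂ
  unital : toLinearMap 1 = 1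
  completelyPositive : ∀ (k n : ℕ) (P : Matrix (Fin k) (Fin n) (NCPoly m)),
    ((ncAdjoint P * P).map toLinearMap).PosSemidef
  tracial : ∀ p q : NCPoly m, toLinearMap (p * q) = toLinearMap (q * p)

/-- The topology of pointwise convergence on `ℂ⟨X₁, …, X_m⟩`. -/
instance (m : ℕ) : TopologicalSpace (NCLaw m) :=
  TopologicalSpace.induced (fun (l : NCLaw m) (p : NCPoly m) => l.toLinearMap p) inferInstance

/-! ### Tracial von Neumann algebras -/

/-- A von Neumann algebra of operators on the Hilbert space `H` with a trace which is continuous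
in the weak operator topology. -/
structure TracialVonNeumannAlgebra (H : Type*) [NormedAddCommGroup H] [InnerProductSpace ℂ H]
    [CompleteSpace H] where
  algebra : VonNeumannAlgebra H
  trace : algebra.toStarSubalgebra →L[ℂ] ℂ
  continuous_wot :
    Continuous[TopologicalSpace.induced
      (fun x : algebra.toStarSubalgebra => ContinuousLinearMapWOT.ofCLM (x : H →L[ℂ] H))
      inferInstance, inferInstance] trace
  trace_one : trace 1 = 1
  trace_mul_comm : ∀ x y, trace (x * y) = trace (y * x)
  trace_star_mul_self : ∀ x, 0 ≤ trace (star x * x)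

/-- `l` is the law of a tuple of self-adjoint elements, of operator norm at most `R`, of some
tracial von Neumann algebra. -/
def NCLaw.IsRealizable {m : ℕ} (l : NCLaw m) (R : ℝ) : Prop :=
  ∃ (H : Type) (_ : NormedAddCommGroup H) (_ : InnerProductSpace ℂ H) (_ : CompleteSpace H)
    (M : TracialVonNeumannAlgebra H) (X : Fin m → M.algebra.toStarSubalgebra),
    (∀ j, IsSelfAdjoint (X j)) ∧ (∀ j, ‖X j‖ ≤ R) ∧
      ∀ p : NCPoly m, l.toLinearMap p = M.trace (ncEval X p)

/-! ### Tuples of self-adjoint matrices -/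

/-- `M_N(ℂ)_sa`. -/
abbrev SAMat (N : ℕ) : Type := selfAdjoint (Matrix (Fin N) (Fin N) ℂ)

instance (N : ℕ) : MeasurableSpace (SAMat N) := borel _

instance (N : ℕ) : BorelSpace (SAMat N) := ⟨rfl⟩

instance (N : ℕ) : SecondCountableTopology (SAMat N) := by
  have : SecondCountableTopology (Matrix (Fin N) (Fin N) ℂ) :=
    inferInstanceAs (SecondCountableTopology (Fin N → Fin N → ℂ))
  exact TopologicalSpace.Subtype.secondCountableTopology _

/-- `M_N(ℂ)_sa^m`. -/
abbrev SATuple (m N : ℕ) : Type := Fin m → SAMat N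

/-- The matrices underlying a tuple of self-adjoint matrices. -/
def SATuple.mat {m N : ℕ} (x : SATuple m N) (j : Fin m) : Matrix (Fin N) (Fin N) ℂ := (x j).1

/-- The normalized trace `τ_N = (1/N) Tr`. -/
def ntrace (N : ℕ) : Matrix (Fin N) (Fin N) ℂ →ₗ[ℂ] ℂ :=
  (N : ℂ)⁻¹ • Matrix.traceLinearMap (Fin N) ℂ ℂ

/-- The operator norm of a matrix acting on `ℂ^N` with its Euclidean norm. -/
def matOpNorm {N : ℕ} (A : Matrix (Fin N) (Fin N) ℂ) : ℝ :=
  ‖Matrix.toEuclideanCLM (n := Fin N) (𝕜 := ℂ) A‖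

/-- `‖x‖_∞ = max_j ‖x_j‖`. -/
def tupleNorm {m N : ℕ} (x : SATuple m N) : ℝ := ⨆ j, matOpNorm (x.mat j)

/-- The self-adjoint matrix whose coordinates are `c` in the following basis, which is orthonormal
for `⟨x, y⟩ = Tr (x y)`: for `k < l`, the coordinate `c k l` belongs to
`(E_{kl} + E_{lk}) / √2` and the coordinate `c l k` to `(i E_{kl} - i E_{lk}) / √2`; the coordinate
`c k k` belongs to `E_{kk}`. -/
def matOfCoords {N : ℕ} (c : Fin N → Fin N → ℝ) : SAMat N :=
  ⟨Matrix.of fun k l =>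
    if k = l then (c k k : ℂ)
    else if k < l then ((c k l : ℂ) + Complex.I * (c l k : ℂ)) / (Real.sqrt 2 : ℂ)
    else ((c l k : ℂ) - Complex.I * (c k l : ℂ)) / (Real.sqrt 2 : ℂ), by
    rw [selfAdjoint.mem_iff]
    ext k l
    rw [Matrix.star_apply, Matrix.of_apply, Matrix.of_apply]
    rcases lt_trichotomy k l with h | h | h
    · simp [h, h.ne, h.ne', h.not_gt, sub_eq_add_neg]
    · subst h; simp
    · simp [h, h.ne, h.ne', h.not_gt, sub_eq_add_neg]⟩

theorem continuous_matOfCoords (N : ℕ) : Continuous (matOfCoords (N := N)) := by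
  unfold matOfCoords
  refine Continuous.subtype_mk (continuous_matrix fun k l => ?_) _
  simp only [Matrix.of_apply]
  split_ifs <;> fun_prop

theorem measurable_matOfCoords (m N : ℕ) :
    Measurable fun (c : Fin m → Fin N → Fin N → ℝ) (j : Fin m) => matOfCoords (c j) :=
  (continuous_pi fun j => (continuous_matOfCoords N).comp (continuous_apply j)).measurable

/-- Lebesgue measure `dx` on `M_N(ℂ)_sa^m`, a real inner product space for
`⟨x, y⟩ = ∑ j, Tr (x_j y_j)`. -/
def lebesgueSA (m N : ℕ) : Measure (SATuple m N) :=
  (volume : Measure (Fin m → Fin N → Fin N → ℝ)).map fun c j => matOfCoords (c j)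

theorem ncEval_ncStar {m N : ℕ} (x : SATuple m N) (p : NCPoly m) :
    ncEval x.mat (ncStar p) = (ncEval x.mat p)ᴴ := by
  have key : ∀ w : FreeMonoid (Fin m),
      FreeMonoid.lift x.mat w.reverse = (FreeMonoid.lift x.mat w)ᴴ := by
    intro w
    induction w using FreeMonoid.inductionOn' with
    | one => exact Matrix.conjTranspose_one.symm
    | of_mul a w ih =>
      rw [FreeMonoid.reverse_mul, map_mul, map_mul, Matrix.conjTranspose_mul, ih]
      congr 1
      rw [FreeMonoid.reverse_of, FreeMonoid.lift_eval_of]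
      exact ((x a).2 : star (x a).1 = (x a).1).symm
  simp only [ncStar, ncEval, Finsupp.sum, map_sum, MonoidAlgebra.lift_single]
  rw [MonoidAlgebra.lift_apply, Finsupp.sum, Matrix.conjTranspose_sum]
  refine Finset.sum_congr rfl fun w _ => ?_
  rw [Matrix.conjTranspose_smul, key]

theorem ntrace_conjTranspose (N : ℕ) (A : Matrix (Fin N) (Fin N) ℂ) :
    ntrace N Aᴴ = star (ntrace N A) := by
  simp [ntrace, Matrix.trace_conjTranspose]

theorem ntrace_nonneg (N : ℕ) (A : Matrix (Fin N) (Fin N) ℂ) : 0 ≤ ntrace N (Aᴴ * A) := by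
  simp only [ntrace, LinearMap.smul_apply, Matrix.traceLinearMap_apply, smul_eq_mul]
  refine mul_nonneg ?_ (Matrix.posSemidef_conjTranspose_mul_self A).trace_nonneg
  rw [← Complex.ofReal_natCast, ← Complex.ofReal_inv]
  exact_mod_cast inv_nonneg.mpr (Nat.cast_nonneg N)

/-- The law `λ_x`, that is `p ↦ τ_N (p x)`, of a tuple of self-adjoint matrices. -/
def matrixLaw {m N : ℕ} [NeZero N] (x : SATuple m N) : NCLaw m where
  toLinearMap := ntrace N ∘ₗ (ncEval x.mat).toLinearMap
  unital := by
    have : (N : ℂ) ≠ 0 := NeZero.ne _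
    simp [ntrace, this]
  tracial p q := by
    simp [ntrace, Matrix.trace_mul_comm (ncEval x.mat p)]
  completelyPositive k n P := by
    set L := ntrace N ∘ₗ (ncEval x.mat).toLinearMap with hL
    have hent : ∀ i j, ((ncAdjoint P * P).map L) i j =
        ∑ r, ntrace N ((ncEval x.mat (P r i))ᴴ * ncEval x.mat (P r j)) := by
      intro i j
      simp [hL, Matrix.map_apply, Matrix.mul_apply, ncAdjoint, ncEval_ncStar]
    refine Matrix.PosSemidef.of_dotProduct_mulVec_nonneg ?_ ?_
    · ext i j
      rw [Matrix.conjTranspose_apply, hent, hent, star_sum]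
      refine Finset.sum_congr rfl fun r _ => ?_
      rw [← ntrace_conjTranspose, Matrix.conjTranspose_mul, Matrix.conjTranspose_conjTranspose]
    · intro c
      have : star c ⬝ᵥ ((ncAdjoint P * P).map L *ᵥ c) =
          ∑ r, ntrace N ((∑ i, c i • ncEval x.mat (P r i))ᴴ *
            ∑ i, c i • ncEval x.mat (P r i)) := by
        have hr : ∀ r, ntrace N ((∑ i, c i • ncEval x.mat (P r i))ᴴ *
            ∑ i, c i • ncEval x.mat (P r i)) = ∑ i, ∑ j, star (c i) * (c j *
              ntrace N ((ncEval x.mat (P r i))ᴴ * ncEval x.mat (P r j))) := by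
          intro r
          rw [Matrix.conjTranspose_sum, Finset.sum_mul_sum, map_sum]
          refine Finset.sum_congr rfl fun i _ => ?_
          rw [map_sum]
          refine Finset.sum_congr rfl fun j _ => ?_
          rw [Matrix.conjTranspose_smul, Matrix.smul_mul, Matrix.mul_smul, map_smul, map_smul,
            smul_eq_mul, smul_eq_mul]
        simp only [hr]
        rw [Finset.sum_comm]
        refine Finset.sum_congr rfl fun i _ => ?_
        rw [Finset.sum_comm]
        simp only [Matrix.mulVec, dotProduct, hent, Pi.star_apply, Finset.mul_sum, Finset.sum_mul]
        refine Finset.sum_congr rfl fun j _ => Finset.sum_congr rfl fun r _ => ?_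
        ring
      rw [this]
      exact Finset.sum_nonneg fun r _ => ntrace_nonneg N _

/-! ### Scalar-valued trace polynomials -/

/-- The linear span of the commutators in `ℂ⟨X₁, …, X_m⟩`. -/
def commutatorSpan (m : ℕ) : Submodule ℂ (NCPoly m) :=
  Submodule.span ℂ {r | ∃ p q : NCPoly m, r = p * q - q * p}

/-- The algebra `TrP_m^0` of scalar-valued trace polynomials: the symmetric algebra of
`ℂ⟨X₁, …, X_m⟩` modulo commutators. The class of `p` is the formal trace `τ(p)`. -/
abbrev TrPoly (m : ℕ) : Type := SymmetricAlgebra ℂ (NCPoly m ⧸ commutatorSpan m)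

/-- The evaluation `l(f)` of a trace polynomial at a law, replacing the formal `τ` by `l`. -/
def NCLaw.evalTrPoly {m : ℕ} (l : NCLaw m) : TrPoly m →ₐ[ℂ] ℂ :=
  SymmetricAlgebra.lift <| (commutatorSpan m).liftQ l.toLinearMap <| by
    rw [commutatorSpan, Submodule.span_le]
    rintro r ⟨p, q, rfl⟩
    simp [l.tracial p q]

/-- The value `f(x)` of a trace polynomial at a tuple of self-adjoint matrices, replacing the formal
`τ` by `τ_N` and `X` by `x`. -/
def TrPoly.evalMat {m N : ℕ} [NeZero N] (f : TrPoly m) (x : SATuple m N) : ℂ :=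
  (matrixLaw x).evalTrPoly f

/-- Asymptotic approximability by scalar-valued trace polynomials. -/
def AsymptoticallyApproximable {m : ℕ} (φ : ∀ N : ℕ+, SATuple m N → ℂ) : Prop :=
  ∀ ε : ℝ, 0 < ε → ∀ R : ℝ, 0 < R → ∃ f : TrPoly m,
    limsup (fun N : ℕ+ => ⨆ (x : SATuple m N) (_ : tupleNorm x ≤ R), ‖φ N x - f.evalMat x‖ₑ) atTop
      ≤ ENNReal.ofReal ε

/-! ### Gibbs measures, classical entropy, microstates free entropy -/

/-- The partition function `Z_N = ∫ exp(-N² V(x)) dx`. -/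
def partitionFn {m N : ℕ} (V : SATuple m N → ℝ) : ℝ≥0∞ :=
  ∫⁻ x, ENNReal.ofReal (Real.exp (-(N : ℝ) ^ 2 * V x)) ∂lebesgueSA m N

/-- The measure `dμ(x) = Z_N⁻¹ exp(-N² V(x)) dx` associated to the potential `V`. -/
def gibbsMeasure {m N : ℕ} (V : SATuple m N → ℝ) : Measure (SATuple m N) :=
  (partitionFn V)⁻¹ •
    (lebesgueSA m N).withDensity fun x => ENNReal.ofReal (Real.exp (-(N : ℝ) ^ 2 * V x))

/-- The density `ρ` of `μ` with respect to Lebesgue measure. -/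
def density {m N : ℕ} (μ : Measure (SATuple m N)) (x : SATuple m N) : ℝ :=
  (μ.rnDeriv (lebesgueSA m N) x).toReal

open scoped Classical in
/-- The classical entropy `h(μ) = ∫ -ρ log ρ` in `[-∞, ∞]`, as the integral of the positive part
minus the integral of the negative part (meaningful unless both are infinite), and `-∞` if `μ`
has no density. -/
def classicalEntropy {m N : ℕ} (μ : Measure (SATuple m N)) : EReal :=
  if μ ≪ lebesgueSA m N then
    ((∫⁻ x, ENNReal.ofReal (Real.negMulLog (density μ x)) ∂lebesgueSA m N : ℝ≥0∞) : EReal) -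
      ((∫⁻ x, ENNReal.ofReal (-Real.negMulLog (density μ x)) ∂lebesgueSA m N : ℝ≥0∞) : EReal)
  else ⊥

/-- `N⁻² h(μ) + (m/2) log N`. -/
def normalizedEntropy {m N : ℕ} (μ : Measure (SATuple m N)) : EReal :=
  (((N : ℝ) ^ 2)⁻¹ : ℝ) * classicalEntropy μ + ((m / 2 * Real.log N : ℝ) : EReal)

/-- The microstate space `Γ_N(𝒰)`. -/
def microstates {m : ℕ} (N : ℕ) [NeZero N] (U : Set (NCLaw m)) : Set (SATuple m N) :=
  {x | matrixLaw x ∈ U}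

/-- The microstate space `Γ_{N,R}(𝒰)` with cut-off `R`. -/
def microstatesR {m : ℕ} (N : ℕ) [NeZero N] (R : ℝ) (U : Set (NCLaw m)) : Set (SATuple m N) :=
  {x | matrixLaw x ∈ U ∧ tupleNorm x ≤ R}

/-- `N⁻² log vol Γ_{N,R}(𝒰) + (m/2) log N`, where `log 0 = -∞`. -/
def normalizedLogVol {m : ℕ} (N : ℕ) [NeZero N] (R : ℝ) (U : Set (NCLaw m)) : EReal :=
  (((N : ℝ) ^ 2)⁻¹ : ℝ) * ENNReal.log (lebesgueSA m N (microstatesR N R U)) +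
    ((m / 2 * Real.log N : ℝ) : EReal)

/-- `χ_R(l)`. -/
def chiR {m : ℕ} (R : ℝ) (l : NCLaw m) : EReal :=
  ⨅ (U : Set (NCLaw m)) (_ : IsOpen U) (_ : l ∈ U),
    limsup (fun N : ℕ+ => normalizedLogVol N R U) atTop

/-- `χ(l)`. -/
def chi {m : ℕ} (l : NCLaw m) : EReal := ⨆ (R : ℝ) (_ : 0 < R), chiR R l

/-- The lower version `χ̲_R(l)`. -/
def chiLowerR {m : ℕ} (R : ℝ) (l : NCLaw m) : EReal :=
  ⨅ (U : Set (NCLaw m)) (_ : IsOpen U) (_ : l ∈ U),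
    liminf (fun N : ℕ+ => normalizedLogVol N R U) atTop

/-- The lower version `χ̲(l)`. -/
def chiLower {m : ℕ} (l : NCLaw m) : EReal := ⨆ (R : ℝ) (_ : 0 < R), chiLowerR R l

/-- The measures `μ_N` concentrate around the law `l`. -/
def ConcentratesAround {m : ℕ} (μ : ∀ N : ℕ+, Measure (SATuple m N)) (l : NCLaw m) : Prop :=
  ∀ U ∈ 𝓝 l, Tendsto (fun N : ℕ+ => μ N (microstates N U)) atTop (𝓝 1)

/-- The function `a + b ∑ j, τ_N (x_j ^ (2 n))`; the traces are real since the matrices are self-adjoint. -/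
def growthBound {m N : ℕ} (n : ℕ) (a b : ℝ) (x : SATuple m N) : ℝ :=
  a + b * ∑ j, (ntrace N (x.mat j ^ (2 * n))).re

end FreeEntropy

end

noncomputable section

namespace FreeEntropy

/-! ### Norm and trace estimates for matrices -/

/-! By (B), on the ball of radius `R` the potential is uniformly close to a trace polynomial `f`,
and `f` depends continuously on the law. So on `Γ_{N,R}(𝒰)`, for `𝒰` small and `N` large, `V_N` is
nearly the constant `v = Re λ(f)`, and the Gibbs measure there is nearly Lebesgue measure times
`exp(-N² v) / Z_N`. By (A) and (D) this set carries almost all the Gibbs mass when `R ≥ R₀`, hence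
`N⁻² log vol Γ_{N,R}(𝒰) ≈ N⁻² log Z_N + v` (`normalizedLog_volume_estimate`).

On the entropy side, `h(μ_N) = log Z_N + N² ∫ V_N dμ_N`, and `∫ V_N dμ_N ≈ v`: the tail `‖x‖_∞ ≥ R₀`
is negligible by (C) and (D), and inside the ball the potential is bounded while the mass off the
microstates vanishes (`lintegral_potential_sub_le`). The two quantities thus agree up to any `d > 0`
for every cut-off `R ≥ R₀`, and `microstates_entropy_eq` passes to limsup and liminf alike.

For realizability, matrices of norm at most `R₀` satisfy `τ_N((x_j p)* (x_j p)) ≤ R₀² τ_N(p* p)`.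
This closed condition is inherited by `λ` (`boundedBy_of_concentrates`), so left and right
multiplications by the variables are bounded on the GNS space. The commutant of the right ones is a
von Neumann algebra containing the left ones, and `inner_mul_comm_of_denseRange` shows that the
vacuum state is a trace on it. -/

theorem matOpNorm_nonneg {N : ℕ} (A : Matrix (Fin N) (Fin N) ℂ) : 0 ≤ matOpNorm A :=
  norm_nonneg _

theorem norm_apply_le_matOpNorm {N : ℕ} (A : Matrix (Fin N) (Fin N) ℂ) (i j : Fin N) :
    ‖A i j‖ ≤ matOpNorm A := by
  have h := (Matrix.toEuclideanCLM (n := Fin N) (𝕜 := ℂ) A).le_opNorm (EuclideanSpace.single j 1)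
  have h2 := PiLp.norm_apply_le
    (Matrix.toEuclideanCLM (n := Fin N) (𝕜 := ℂ) A (EuclideanSpace.single j 1)) i
  rw [Matrix.ofLp_toEuclideanCLM] at h2
  simp only [PiLp.norm_single, norm_one, mul_one] at h
  simpa [matOpNorm] using h2.trans h

theorem norm_ntrace_le {N : ℕ} [NeZero N] (A : Matrix (Fin N) (Fin N) ℂ) :
    ‖ntrace N A‖ ≤ matOpNorm A := by
  have hN : (0 : ℝ) < N := by exact_mod_cast Nat.pos_of_ne_zero (NeZero.ne N)
  have h : ‖A.trace‖ ≤ N * matOpNorm A := by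
    refine (norm_sum_le _ _).trans ?_
    refine (Finset.sum_le_sum fun i _ => norm_apply_le_matOpNorm A i i).trans ?_
    simp
  simp only [ntrace, LinearMap.smul_apply, Matrix.traceLinearMap_apply, smul_eq_mul, norm_mul,
    norm_inv, Complex.norm_natCast]
  rw [inv_mul_le_iff₀ hN]
  exact h

theorem matOpNorm_pow_le {N : ℕ} (A : Matrix (Fin N) (Fin N) ℂ) {k : ℕ} (hk : 0 < k) :
    matOpNorm (A ^ k) ≤ matOpNorm A ^ k := by
  unfold matOpNorm
  rw [map_pow]
  exact norm_pow_le' _ hk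

theorem matOpNorm_le_tupleNorm {m N : ℕ} (x : SATuple m N) (j : Fin m) :
    matOpNorm (x.mat j) ≤ tupleNorm x :=
  le_ciSup (f := fun j => matOpNorm (x.mat j)) (Set.finite_range _).bddAbove j

theorem SATuple.conjTranspose_mat {m N : ℕ} (x : SATuple m N) (j : Fin m) :
    (x.mat j)ᴴ = x.mat j :=
  (x j).2

theorem ntrace_even_pow_nonneg {m N : ℕ} (x : SATuple m N) (j : Fin m) (n : ℕ) :
    0 ≤ (ntrace N (x.mat j ^ (2 * n))).re := by
  have h := ntrace_nonneg N (x.mat j ^ n)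
  rw [Matrix.conjTranspose_pow, x.conjTranspose_mat, ← pow_add, ← two_mul] at h
  exact (Complex.le_def.1 h).1

theorem le_growthBound {m N : ℕ} (n : ℕ) (a : ℝ) {b : ℝ} (hb : 0 ≤ b) (x : SATuple m N) :
    a ≤ growthBound n a b x :=
  le_add_of_nonneg_right
    (mul_nonneg hb (Finset.sum_nonneg fun j _ => ntrace_even_pow_nonneg x j n))

theorem growthBound_le {m N : ℕ} [NeZero N] {n : ℕ} (hn : 1 ≤ n) (a : ℝ) {b : ℝ} (hb : 0 ≤ b)
    {R : ℝ} {x : SATuple m N} (hx : tupleNorm x ≤ R) :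
    growthBound n a b x ≤ a + b * (m * R ^ (2 * n)) := by
  unfold growthBound
  gcongr
  have : ∀ j ∈ Finset.univ, (ntrace N (x.mat j ^ (2 * n))).re ≤ R ^ (2 * n) := fun j _ =>
    calc _ ≤ ‖ntrace N (x.mat j ^ (2 * n))‖ := Complex.re_le_norm _
      _ ≤ matOpNorm (x.mat j ^ (2 * n)) := norm_ntrace_le _
      _ ≤ matOpNorm (x.mat j) ^ (2 * n) := matOpNorm_pow_le _ (by omega)
      _ ≤ R ^ (2 * n) :=
        pow_le_pow_left₀ (matOpNorm_nonneg _) ((matOpNorm_le_tupleNorm x j).trans hx) _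
  simpa using Finset.sum_le_sum this

/-- Absorbs the bound of (C) and an additive constant into a multiple of the integrand of (D);
nonnegativity of the even moments makes this possible. -/
theorem growthBound_le_mul {m N : ℕ} (n : ℕ) {a b c : ℝ} (ha : 0 ≤ a) (hb : 0 ≤ b) (hc : 0 ≤ c)
    (x : SATuple m N) :
    growthBound n a b x + c ≤ (a + b + c) * growthBound n 1 1 x := by
  have h := le_growthBound n 0 (zero_le_one' ℝ) x
  simp only [growthBound, zero_add, one_mul] at h ⊢
  nlinarith

theorem re_trace_conjTranspose_mul_self {N : ℕ} (A : Matrix (Fin N) (Fin N) ℂ) :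
    (Aᴴ * A).trace.re = ∑ i, ‖WithLp.toLp 2 (A.col i)‖ ^ 2 := by
  simp only [Matrix.trace, Matrix.diag_apply, Matrix.mul_apply, Matrix.conjTranspose_apply,
    EuclideanSpace.norm_sq_eq, Complex.re_sum]
  refine Finset.sum_congr rfl fun i _ => Finset.sum_congr rfl fun k _ => ?_
  rw [Complex.star_def, ← Complex.normSq_eq_conj_mul_self, Complex.ofReal_re,
    Complex.normSq_eq_norm_sq]
  rfl

/-- Column by column: `Tr(A* A)` is the sum of the squared column norms of `A`, and the columns of
`B * A` are the images under `B` of those of `A`. -/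
theorem re_ntrace_mul_le {N : ℕ} (B A : Matrix (Fin N) (Fin N) ℂ) {R : ℝ}
    (hB : matOpNorm B ≤ R) :
    (ntrace N ((B * A)ᴴ * (B * A))).re ≤ R ^ 2 * (ntrace N (Aᴴ * A)).re := by
  have key : ((B * A)ᴴ * (B * A)).trace.re ≤ R ^ 2 * (Aᴴ * A).trace.re := by
    rw [re_trace_conjTranspose_mul_self, re_trace_conjTranspose_mul_self, Finset.mul_sum]
    refine Finset.sum_le_sum fun i _ => ?_
    rw [← mul_pow]
    refine pow_le_pow_left₀ (norm_nonneg _) ?_ _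
    have h := (Matrix.toEuclideanCLM (n := Fin N) (𝕜 := ℂ) B).le_of_opNorm_le hB
      (WithLp.toLp 2 (A.col i))
    rw [Matrix.toEuclideanCLM_toLp] at h
    exact h
  have hr : ∀ C : Matrix (Fin N) (Fin N) ℂ, (ntrace N C).re = (N : ℝ)⁻¹ * C.trace.re := by
    intro C
    simp only [ntrace, LinearMap.smul_apply, Matrix.traceLinearMap_apply, smul_eq_mul]
    rw [← Complex.ofReal_natCast, ← Complex.ofReal_inv, Complex.re_ofReal_mul]
  rw [hr, hr, mul_left_comm]
  exact mul_le_mul_of_nonneg_left key (by positivity)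

/-! ### Continuity and measurability -/

theorem continuous_mat {m N : ℕ} (j : Fin m) : Continuous fun x : SATuple m N => x.mat j :=
  continuous_subtype_val.comp (continuous_apply j)

theorem continuous_ntrace (N : ℕ) : Continuous (ntrace N) := by
  have h : (ntrace N : Matrix (Fin N) (Fin N) ℂ → ℂ) = fun A => (N : ℂ)⁻¹ * A.trace := rfl
  rw [h]
  exact continuous_const.mul continuous_id.matrix_trace

theorem continuous_matOpNorm (N : ℕ) : Continuous (matOpNorm (N := N)) := by
  refine continuous_norm.comp ?_
  exact LinearMap.continuous_of_finiteDimensional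
    (Matrix.toEuclideanCLM (n := Fin N) (𝕜 := ℂ)).toAlgEquiv.toLinearMap

theorem measurable_tupleNorm (m N : ℕ) : Measurable (tupleNorm (m := m) (N := N)) :=
  Measurable.iSup fun j => ((continuous_matOpNorm N).comp (continuous_mat j)).measurable

theorem measurable_growthBound {m N : ℕ} (n : ℕ) (a b : ℝ) :
    Measurable (growthBound (m := m) (N := N) n a b) := by
  have : Continuous (growthBound (m := m) (N := N) n a b) :=
    continuous_const.add (continuous_const.mul (continuous_finsetSum _ fun j _ =>
      Complex.continuous_re.comp ((continuous_ntrace N).comp ((continuous_mat j).pow _))))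
  exact this.measurable

theorem continuous_ncEval_mat {m N : ℕ} (p : NCPoly m) :
    Continuous fun x : SATuple m N => ncEval x.mat p := by
  have hw : ∀ w : FreeMonoid (Fin m),
      Continuous fun x : SATuple m N => FreeMonoid.lift x.mat w := by
    intro w
    induction w using FreeMonoid.inductionOn' with
    | one => simpa using continuous_const
    | of_mul a w ih =>
      simp only [map_mul, FreeMonoid.lift_eval_of]
      exact (continuous_mat a).mul ih
  simp only [ncEval, MonoidAlgebra.lift_apply, Finsupp.sum]
  exact continuous_finsetSum _ fun w _ => (hw w).const_smul (p.coeff w)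

theorem continuous_apply_law {m : ℕ} (p : NCPoly m) :
    Continuous fun l : NCLaw m => l.toLinearMap p :=
  (continuous_apply p).comp continuous_induced_dom

theorem continuous_matrixLaw (m N : ℕ) [NeZero N] :
    Continuous (matrixLaw : SATuple m N → NCLaw m) :=
  continuous_induced_rng.2 <| continuous_pi fun p =>
    (continuous_ntrace N).comp (continuous_ncEval_mat p)

/-- Sums and products of the coordinates `l ↦ l(p)` suffice. This links concentration in law to the
approximation in (B). -/
theorem continuous_evalTrPoly {m : ℕ} (f : TrPoly m) :
    Continuous fun l : NCLaw m => l.evalTrPoly f := by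
  induction f using SymmetricAlgebra.induction with
  | algebraMap r => simpa using continuous_const
  | ι x =>
    obtain ⟨p, rfl⟩ := Submodule.Quotient.mk_surjective _ x
    simp only [NCLaw.evalTrPoly, SymmetricAlgebra.lift_ι_apply]
    exact continuous_apply_law p
  | mul a b ha hb => simp only [map_mul]; exact ha.mul hb
  | add a b ha hb => simp only [map_add]; exact ha.add hb

/-! ### Gibbs measures -/

section Gibbs

variable {m N : ℕ} {V : SATuple m N → ℝ}

/-- The unnormalized Gibbs density. -/
def gibbsWeight (V : SATuple m N → ℝ) (x : SATuple m N) : ℝ≥0∞ :=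
  ENNReal.ofReal (Real.exp (-(N : ℝ) ^ 2 * V x))

theorem measurable_gibbsWeight (hV : Measurable V) : Measurable (gibbsWeight V) :=
  (Real.measurable_exp.comp (hV.const_mul _)).ennreal_ofReal

theorem gibbsWeight_ne_zero (x : SATuple m N) : gibbsWeight V x ≠ 0 := by
  simp [gibbsWeight, Real.exp_pos]

theorem gibbsWeight_ne_top (x : SATuple m N) : gibbsWeight V x ≠ ∞ := ENNReal.ofReal_ne_top

/-- The measure `exp(-N² V) dx` is finite with a positive finite density; dividing by that density
returns `dx` and preserves σ-finiteness, which the Radon–Nikodym derivative needs. -/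
theorem sigmaFinite_lebesgueSA (hV : Measurable V) (hZ : partitionFn V < ∞) :
    SigmaFinite (lebesgueSA m N) := by
  have hm := measurable_gibbsWeight hV
  have : IsFiniteMeasure ((lebesgueSA m N).withDensity (gibbsWeight V)) :=
    isFiniteMeasure_withDensity hZ.ne
  have h := withDensity_inv_same (μ := lebesgueSA m N) hm
    (ae_of_all _ fun x => gibbsWeight_ne_zero x) (ae_of_all _ fun x => gibbsWeight_ne_top x)
  rw [← h]
  exact SigmaFinite.withDensity_of_ne_top
    (ae_of_all _ fun x => ENNReal.inv_ne_top.2 (gibbsWeight_ne_zero x))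

theorem gibbsMeasure_eq_withDensity (hV : Measurable V) :
    gibbsMeasure V =
      (lebesgueSA m N).withDensity fun x => (partitionFn V)⁻¹ * gibbsWeight V x :=
  (withDensity_smul _ (measurable_gibbsWeight hV)).symm

theorem isProbabilityMeasure_gibbsMeasure (hZ : partitionFn V < ∞) (hZ0 : partitionFn V ≠ 0) :
    IsProbabilityMeasure (gibbsMeasure V) := by
  constructor
  rw [gibbsMeasure, Measure.smul_apply, withDensity_apply _ MeasurableSet.univ,
    Measure.restrict_univ, smul_eq_mul]
  exact ENNReal.inv_mul_cancel hZ0 hZ.ne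

theorem partitionFn_mul_gibbsMeasure (hZ : partitionFn V < ∞) (hZ0 : partitionFn V ≠ 0)
    {S : Set (SATuple m N)} (hS : MeasurableSet S) :
    partitionFn V * gibbsMeasure V S = ∫⁻ x in S, gibbsWeight V x ∂lebesgueSA m N := by
  rw [gibbsMeasure, Measure.smul_apply, withDensity_apply _ hS, smul_eq_mul, ← mul_assoc,
    ENNReal.mul_inv_cancel hZ0 hZ.ne, one_mul]
  rfl

/-- If `Z = 0`, the weighted measure is zero and stays zero after scaling by `Z⁻¹ = ∞`. Positivity
of `Z_N` for large `N` can therefore be read off from (A). -/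
theorem partitionFn_ne_zero_of_gibbsMeasure {S : Set (SATuple m N)} (h : gibbsMeasure V S ≠ 0) :
    partitionFn V ≠ 0 := by
  intro h0
  apply h
  have : (lebesgueSA m N).withDensity (gibbsWeight V) = 0 := by
    rw [← Measure.measure_univ_eq_zero, withDensity_apply _ MeasurableSet.univ,
      Measure.restrict_univ]
    exact h0
  have h2 : gibbsMeasure V = (partitionFn V)⁻¹ • (lebesgueSA m N).withDensity (gibbsWeight V) := rfl
  rw [h2, this]
  simp

/-- Here `-log ρ = log Z + N² V`; keeping `ρ` as a scalar factor turns integrals against `dx` into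
integrals against the Gibbs measure. -/
theorem negMulLog_density_ae (hV : Measurable V) (hZ : partitionFn V < ∞)
    (hZ0 : partitionFn V ≠ 0) :
    (fun x => Real.negMulLog (density (gibbsMeasure V) x)) =ᵐ[lebesgueSA m N] fun x =>
      ((partitionFn V)⁻¹ * gibbsWeight V x).toReal •
        (Real.log (partitionFn V).toReal + (N : ℝ) ^ 2 * V x) := by
  have := sigmaFinite_lebesgueSA hV hZ
  have hd := Measure.rnDeriv_withDensity (lebesgueSA m N)
    ((measurable_gibbsWeight hV).const_mul (partitionFn V)⁻¹)
  rw [← gibbsMeasure_eq_withDensity hV] at hd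
  filter_upwards [hd] with x hx
  have hpos : 0 < (partitionFn V).toReal := ENNReal.toReal_pos hZ0 hZ.ne
  rw [density, hx, smul_eq_mul, Real.negMulLog, neg_mul, ← mul_neg]
  congr 1
  rw [ENNReal.toReal_mul, ENNReal.toReal_inv, gibbsWeight,
    ENNReal.toReal_ofReal (Real.exp_pos _).le, Real.log_mul (by positivity) (Real.exp_ne_zero _),
    Real.log_inv, Real.log_exp]
  ring

theorem integrable_negMulLog_density (hV : Measurable V) (hZ : partitionFn V < ∞)
    (hZ0 : partitionFn V ≠ 0) (hint : Integrable V (gibbsMeasure V)) :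
    Integrable (fun x => Real.negMulLog (density (gibbsMeasure V) x)) (lebesgueSA m N) ∧
    ∫ x, Real.negMulLog (density (gibbsMeasure V) x) ∂lebesgueSA m N =
      Real.log (partitionFn V).toReal + (N : ℝ) ^ 2 * ∫ x, V x ∂gibbsMeasure V := by
  have hprob := isProbabilityMeasure_gibbsMeasure hZ hZ0
  have hmeas := (measurable_gibbsWeight hV).const_mul (partitionFn V)⁻¹
  have hfin : ∀ᵐ x ∂lebesgueSA m N, (partitionFn V)⁻¹ * gibbsWeight V x < ∞ :=
    ae_of_all _ fun x => ENNReal.mul_lt_top (ENNReal.inv_lt_top.2 (pos_iff_ne_zero.2 hZ0))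
      (gibbsWeight_ne_top x).lt_top
  have hae := negMulLog_density_ae hV hZ hZ0
  have hint2 : Integrable (fun x => Real.log (partitionFn V).toReal + (N : ℝ) ^ 2 * V x)
      (gibbsMeasure V) := (integrable_const _).add (hint.const_mul _)
  constructor
  · rw [integrable_congr hae]
    rw [gibbsMeasure_eq_withDensity hV] at hint2
    exact (integrable_withDensity_iff_integrable_smul' hmeas hfin).1 hint2
  · rw [integral_congr_ae hae, ← integral_withDensity_eq_integral_toReal_smul hmeas hfin,
      ← gibbsMeasure_eq_withDensity hV, integral_add (integrable_const _) (hint.const_mul _),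
      integral_const_mul]
    simp

theorem classicalEntropy_gibbsMeasure (hV : Measurable V) (hZ : partitionFn V < ∞)
    (hZ0 : partitionFn V ≠ 0) (hint : Integrable V (gibbsMeasure V)) :
    classicalEntropy (gibbsMeasure V) =
      ((Real.log (partitionFn V).toReal + (N : ℝ) ^ 2 * ∫ x, V x ∂gibbsMeasure V : ℝ) : EReal) := by
  obtain ⟨hi, he⟩ := integrable_negMulLog_density hV hZ hZ0 hint
  have hac : gibbsMeasure V ≪ lebesgueSA m N := by
    rw [gibbsMeasure_eq_withDensity hV]
    exact withDensity_absolutelyContinuous _ _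
  rw [classicalEntropy, if_pos hac, ← he, integral_eq_lintegral_pos_part_sub_lintegral_neg_part hi,
    EReal.coe_sub]
  congr 1
  · exact (EReal.coe_ennreal_toReal hi.lintegral_lt_top.ne).symm
  · exact (EReal.coe_ennreal_toReal hi.neg.lintegral_lt_top.ne).symm

theorem normalizedEntropy_gibbsMeasure [NeZero N] (hV : Measurable V) (hZ : partitionFn V < ∞)
    (hZ0 : partitionFn V ≠ 0) (hint : Integrable V (gibbsMeasure V)) :
    normalizedEntropy (gibbsMeasure V) =
      ((((N : ℝ) ^ 2)⁻¹ * Real.log (partitionFn V).toReal + ∫ x, V x ∂gibbsMeasure V +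
        m / 2 * Real.log N : ℝ) : EReal) := by
  have hN : (N : ℝ) ≠ 0 := NeZero.ne _
  rw [normalizedEntropy, classicalEntropy_gibbsMeasure hV hZ hZ0 hint, ← EReal.coe_mul,
    ← EReal.coe_add]
  congr 1
  field_simp

/-- On a set where `V` is within `d` of `v`, volume and Gibbs measure determine each other up to
exponential errors. -/
theorem normalizedLog_volume_estimate [NeZero N] (hZ : partitionFn V < ∞)
    {S : Set (SATuple m N)} (hS : MeasurableSet S) {v d : ℝ} (hv : ∀ x ∈ S, |V x - v| ≤ d)
    (hμ : ENNReal.ofReal (Real.exp (-d)) ≤ gibbsMeasure V S) :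
    ∃ r : ℝ, ENNReal.log (lebesgueSA m N S) = r ∧
      |((N : ℝ) ^ 2)⁻¹ * r - (((N : ℝ) ^ 2)⁻¹ * Real.log (partitionFn V).toReal + v)| ≤ 2 * d := by
  -- The potential costs `N² d` and `-log μ(S)` at most `d`; since `N² ≥ 1`, the total is at most `2
  -- N² d`.
  have hN1 : (1 : ℝ) ≤ (N : ℝ) ^ 2 :=
    one_le_pow₀ (by exact_mod_cast Nat.one_le_iff_ne_zero.2 (NeZero.ne N))
  have hN : (0 : ℝ) < (N : ℝ) ^ 2 := by linarith
  have hμ0 : gibbsMeasure V S ≠ 0 := by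
    intro h
    rw [h, nonpos_iff_eq_zero, ENNReal.ofReal_eq_zero] at hμ
    exact absurd hμ (not_le.2 (Real.exp_pos _))
  have hZ0 := partitionFn_ne_zero_of_gibbsMeasure hμ0
  have hprob := isProbabilityMeasure_gibbsMeasure hZ hZ0
  have key := partitionFn_mul_gibbsMeasure hZ hZ0 hS
  obtain ⟨x₀, hx₀⟩ : S.Nonempty := by
    by_contra h
    rw [Set.not_nonempty_iff_eq_empty] at h
    simp [h] at hμ0
  have hd : 0 ≤ d := (abs_nonneg _).trans (hv x₀ hx₀)
  have hlow : ENNReal.ofReal (Real.exp (-(N : ℝ) ^ 2 * (v + d))) * lebesgueSA m N S ≤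
      partitionFn V * gibbsMeasure V S := by
    rw [key, ← setLIntegral_const]
    refine setLIntegral_mono' hS fun x hx => ENNReal.ofReal_le_ofReal (Real.exp_le_exp.2 ?_)
    have := (abs_le.1 (hv x hx)).2
    nlinarith
  have hup : partitionFn V * gibbsMeasure V S ≤
      ENNReal.ofReal (Real.exp (-(N : ℝ) ^ 2 * (v - d))) * lebesgueSA m N S := by
    rw [key, ← setLIntegral_const]
    refine setLIntegral_mono' hS fun x hx => ENNReal.ofReal_le_ofReal (Real.exp_le_exp.2 ?_)
    have := (abs_le.1 (hv x hx)).1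
    nlinarith
  -- The sandwich of `Z μ(S)` also forces the volume to be positive and finite, so its logarithm is
  -- real.
  have hL0 : lebesgueSA m N S ≠ 0 := by
    intro h
    rw [h, mul_zero, nonpos_iff_eq_zero] at hup
    exact (mul_ne_zero hZ0 hμ0) hup
  have hLt : lebesgueSA m N S ≠ ∞ := by
    intro h
    rw [h, ENNReal.mul_top (by simp [Real.exp_pos])] at hlow
    exact (ENNReal.mul_lt_top hZ (measure_lt_top _ _)).not_ge hlow
  refine ⟨_, ENNReal.log_pos_real hL0 hLt, ?_⟩
  set L := (lebesgueSA m N S).toReal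
  set z := (partitionFn V).toReal
  have hLpos : 0 < L := ENNReal.toReal_pos hL0 hLt
  have hz : 0 < z := ENNReal.toReal_pos hZ0 hZ.ne
  set μ := (gibbsMeasure V S).toReal
  have hμpos : 0 < μ := ENNReal.toReal_pos hμ0 (measure_ne_top _ _)
  have hμ1 : μ ≤ 1 := by
    have := ENNReal.toReal_mono ENNReal.one_ne_top (prob_le_one (μ := gibbsMeasure V) (s := S))
    simpa using this
  have hμd : Real.exp (-d) ≤ μ := by
    have := ENNReal.toReal_mono (measure_ne_top _ _) hμ
    rwa [ENNReal.toReal_ofReal (Real.exp_pos _).le] at this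
  have hlow' : Real.exp (-(N : ℝ) ^ 2 * (v + d)) * L ≤ z * μ := by
    have := ENNReal.toReal_mono (ENNReal.mul_ne_top hZ.ne (measure_ne_top _ _)) hlow
    rwa [ENNReal.toReal_mul, ENNReal.toReal_mul, ENNReal.toReal_ofReal (Real.exp_pos _).le] at this
  have hup' : z * μ ≤ Real.exp (-(N : ℝ) ^ 2 * (v - d)) * L := by
    have := ENNReal.toReal_mono (ENNReal.mul_ne_top ENNReal.ofReal_ne_top hLt) hup
    rwa [ENNReal.toReal_mul, ENNReal.toReal_mul, ENNReal.toReal_ofReal (Real.exp_pos _).le] at this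
  have h1 := Real.log_le_log (by positivity) hlow'
  have h2 := Real.log_le_log (by positivity) hup'
  rw [Real.log_mul (by positivity) (by positivity), Real.log_mul (by positivity) (by positivity),
    Real.log_exp] at h1 h2
  have h3 : Real.log μ ≤ 0 := Real.log_nonpos hμpos.le hμ1
  have h4 : -d ≤ Real.log μ := (Real.le_log_iff_exp_le hμpos).2 hμd
  have e : ((N : ℝ) ^ 2)⁻¹ * Real.log L - (((N : ℝ) ^ 2)⁻¹ * Real.log z + v) =
      (Real.log L - Real.log z - (N : ℝ) ^ 2 * v) / (N : ℝ) ^ 2 := by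
    rw [sub_div, sub_div, mul_div_cancel_left₀ _ hN.ne']
    ring
  rw [e, abs_le, le_div_iff₀ hN, div_le_iff₀ hN]
  constructor <;> nlinarith

end Gibbs

/-! ### Asymptotic comparison of extended real sequences -/

theorem ereal_le_of_forall_pos_le_add {x y : EReal} (h : ∀ d : ℝ, 0 < d → x ≤ y + d) : x ≤ y := by
  rw [← EReal.le_of_forall_lt_iff_le]
  intro z hz
  induction y with
  | bot => simpa using (h 1 one_pos).trans (by simp : (⊥ : EReal) + ((1 : ℝ) : EReal) ≤ z)
  | top => simp at hz
  | coe r =>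
    have := h (z - r) (sub_pos.2 (EReal.coe_lt_coe_iff.1 hz))
    rwa [← EReal.coe_add, add_sub_cancel] at this

theorem limsup_le_limsup_add_coe {ι : Type*} {F : Filter ι} [NeBot F] {u w : ι → EReal} {d : ℝ}
    (h : ∀ᶠ i in F, u i ≤ w i + d) : limsup u F ≤ limsup w F + d := by
  refine (limsup_le_limsup h).trans ?_
  have := EReal.limsup_add_le (f := F) (u := w) (v := fun _ => (d : EReal))
    (.inr (by simp)) (.inr (by simp))
  rwa [limsup_const] at this

theorem liminf_le_liminf_add_coe {ι : Type*} {F : Filter ι} [NeBot F] {u w : ι → EReal} {d : ℝ}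
    (h : ∀ᶠ i in F, u i ≤ w i + d) : liminf u F ≤ liminf w F + d := by
  refine (liminf_le_liminf h).trans ?_
  -- The constant takes the limsup slot of this inequality, leaving the liminf on `w`.
  have := EReal.liminf_add_le (f := F) (u := fun _ => (d : EReal)) (v := w)
    (.inl (by simp)) (.inl (by simp))
  rw [limsup_const] at this
  rw [add_comm]
  refine le_trans (le_of_eq ?_) this
  congr 1
  ext i
  exact add_comm _ _

/-! ### Concentration -/

theorem normalizedLogVol_mono {m : ℕ} (N : ℕ) [NeZero N] {R S : ℝ} (hRS : R ≤ S)
    {U W : Set (NCLaw m)} (h : U ⊆ W) : normalizedLogVol N R U ≤ normalizedLogVol N S W := by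
  unfold normalizedLogVol
  refine add_le_add (mul_le_mul_of_nonneg_left (ENNReal.log_monotone (measure_mono ?_)) ?_) le_rfl
  · exact fun x hx => ⟨h hx.1, hx.2.trans hRS⟩
  · exact_mod_cast inv_nonneg.2 (sq_nonneg (N : ℝ))

theorem measurableSet_microstates {m : ℕ} (N : ℕ) [NeZero N] {U : Set (NCLaw m)} (hU : IsOpen U) :
    MeasurableSet (microstates N U) :=
  (hU.preimage (continuous_matrixLaw m N)).measurableSet

theorem measurableSet_microstatesR {m : ℕ} (N : ℕ) [NeZero N] (R : ℝ) {U : Set (NCLaw m)}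
    (hU : IsOpen U) : MeasurableSet (microstatesR N R U) :=
  (measurableSet_microstates N hU).inter (measurable_tupleNorm m N measurableSet_Iic)

section Concentration

variable {m : ℕ} {V : ∀ N : ℕ+, SATuple m N → ℝ} {l : NCLaw m} {n : ℕ} {R₀ : ℝ}

/-- The summand `1` in the integrand of (D) makes it control the mass of the tail as well as its
moments. -/
theorem measure_tail_le {N : ℕ} (μ : Measure (SATuple m N)) (n : ℕ) (R₀ : ℝ) :
    μ {x | R₀ ≤ tupleNorm x} ≤
      ∫⁻ x in {x : SATuple m N | R₀ ≤ tupleNorm x}, ENNReal.ofReal (growthBound n 1 1 x) ∂μ := by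
  rw [← setLIntegral_one]
  exact lintegral_mono fun x => ENNReal.one_le_ofReal.2 (le_growthBound n 1 zero_le_one x)

/-- The cut-off removes only points of the tail, whose mass vanishes by (D). -/
theorem eventually_le_measure_microstatesR
    (hA : ConcentratesAround (fun N => gibbsMeasure (V N)) l)
    (hD : Tendsto (fun N : ℕ+ => ∫⁻ x in {x : SATuple m N | R₀ ≤ tupleNorm x},
      ENNReal.ofReal (growthBound n 1 1 x) ∂gibbsMeasure (V N)) atTop (𝓝 0))
    {R : ℝ} (hR : R₀ ≤ R) {U : Set (NCLaw m)} (hU : U ∈ 𝓝 l) {c : ℝ≥0∞} (hc : c < 1) :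
    ∀ᶠ N : ℕ+ in atTop, c ≤ gibbsMeasure (V N) (microstatesR N R U) := by
  have h := ENNReal.Tendsto.sub (hA U hU) hD (.inl ENNReal.one_ne_top)
  rw [tsub_zero] at h
  filter_upwards [h.eventually (lt_mem_nhds hc)] with N hN
  refine hN.le.trans (tsub_le_iff_right.2 ?_)
  refine le_trans ?_ (add_le_add le_rfl (measure_tail_le _ n R₀))
  refine (measure_mono fun x hx => ?_).trans (measure_union_le _ _)
  rcases le_total R₀ (tupleNorm x) with h' | h'
  · exact .inr h'
  · exact .inl ⟨hx, h'.trans hR⟩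

theorem eventually_partitionFn_ne_zero
    (hA : ConcentratesAround (fun N => gibbsMeasure (V N)) l) :
    ∀ᶠ N : ℕ+ in atTop, partitionFn (V N) ≠ 0 := by
  filter_upwards [(hA _ univ_mem).eventually (lt_mem_nhds zero_lt_one)] with N hN
  exact partitionFn_ne_zero_of_gibbsMeasure hN.ne'

theorem tendsto_measure_compl_microstates (hZ : ∀ N, partitionFn (V N) < ∞)
    (hA : ConcentratesAround (fun N => gibbsMeasure (V N)) l)
    {U : Set (NCLaw m)} (hU : IsOpen U) (hl : l ∈ U) :
    Tendsto (fun N : ℕ+ => gibbsMeasure (V N) (microstates N U)ᶜ) atTop (𝓝 0) := by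
  have h := ENNReal.Tendsto.sub (tendsto_const_nhds (x := (1 : ℝ≥0∞))) (hA U (hU.mem_nhds hl))
    (.inl ENNReal.one_ne_top)
  rw [tsub_self] at h
  refine h.congr' ?_
  filter_upwards [eventually_partitionFn_ne_zero hA] with N hN
  have := isProbabilityMeasure_gibbsMeasure (hZ N) hN
  exact (prob_compl_eq_one_sub (measurableSet_microstates N hU)).symm

/-- A trace-polynomial approximation pins the potential down near the limit law. -/
theorem exists_eventually_potential_close
    (hB : AsymptoticallyApproximable fun N x => (V N x : ℂ)) (l : NCLaw m)
    {d : ℝ} (hd : 0 < d) {R : ℝ} (hR : 0 < R) :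
    ∃ (v : ℝ) (U : Set (NCLaw m)), IsOpen U ∧ l ∈ U ∧
      ∀ᶠ N : ℕ+ in atTop, ∀ x ∈ microstatesR N R U, |V N x - v| ≤ d := by
  -- Asking for `d / 4` puts the limsup strictly below `d / 2`, so that the bound `d / 2` holds
  -- eventually.
  obtain ⟨f, hf⟩ := hB (d / 4) (by positivity) R hR
  -- `f` may take complex values; since `V_N` is real, passing to the real part does not increase
  -- the distance.
  refine ⟨(l.evalTrPoly f).re, {k | ‖k.evalTrPoly f - l.evalTrPoly f‖ < d / 2}, ?_, ?_, ?_⟩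
  · exact isOpen_lt ((continuous_evalTrPoly f).sub continuous_const).norm continuous_const
  · simpa using hd
  · have hlt := eventually_lt_of_limsup_lt (hf.trans_lt
      ((ENNReal.ofReal_lt_ofReal_iff (by positivity : 0 < d / 2)).2 (by linarith)))
    filter_upwards [hlt] with N hN x hx
    have h1 : ‖(V N x : ℂ) - f.evalMat x‖ ≤ d / 2 := by
      have := (le_iSup₂ (f := fun (x : SATuple m N) (_ : tupleNorm x ≤ R) =>
        ‖(V N x : ℂ) - f.evalMat x‖ₑ) x hx.2).trans hN.le
      rw [← ofReal_norm] at this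
      exact (ENNReal.ofReal_le_ofReal_iff (by positivity)).1 this
    have h2 : ‖f.evalMat x - l.evalTrPoly f‖ < d / 2 := hx.1
    calc |V N x - (l.evalTrPoly f).re| = |((V N x : ℂ) - l.evalTrPoly f).re| := by simp
      _ ≤ ‖(V N x : ℂ) - l.evalTrPoly f‖ := Complex.abs_re_le_norm _
      _ ≤ ‖(V N x : ℂ) - f.evalMat x‖ + ‖f.evalMat x - l.evalTrPoly f‖
        := norm_sub_le_norm_sub_add_norm_sub _ _ _
      _ ≤ d := by linarith

/-- Three regions: on the microstates inside the ball of radius `R₀` the error is `d`; on the tail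
the growth bound applies; on the rest of the ball the integrand is bounded by a constant. -/
theorem lintegral_potential_sub_le {N : ℕ} [NeZero N] {W : SATuple m N → ℝ}
    (hn : 1 ≤ n) {a b : ℝ} (ha : 0 ≤ a) (hb : 0 ≤ b)
    (hC : ∀ x, |W x| ≤ growthBound n a b x) {R : ℝ} (hR : R₀ ≤ R)
    {U : Set (NCLaw m)} (hU : IsOpen U) {v d : ℝ} (hv : ∀ x ∈ microstatesR N R U, |W x - v| ≤ d)
    (μ : Measure (SATuple m N)) [IsProbabilityMeasure μ] :
    ∫⁻ x, ‖W x - v‖ₑ ∂μ ≤ ENNReal.ofReal d +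
      (ENNReal.ofReal (a + b + |v|) * ∫⁻ x in {x : SATuple m N | R₀ ≤ tupleNorm x},
        ENNReal.ofReal (growthBound n 1 1 x) ∂μ +
      ENNReal.ofReal (a + b * (m * R₀ ^ (2 * n)) + |v|) * μ (microstates N U)ᶜ) := by
  set T := {x : SATuple m N | R₀ ≤ tupleNorm x}
  set c := ENNReal.ofReal (a + b + |v|)
  set K := ENNReal.ofReal (a + b * (m * R₀ ^ (2 * n)) + |v|)
  have hT : MeasurableSet T := measurable_tupleNorm m N measurableSet_Ici
  have hS := (measurableSet_microstates N hU).compl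
  have hg : Measurable fun x : SATuple m N => ENNReal.ofReal (growthBound n 1 1 x) :=
    (measurable_growthBound n 1 1).ennreal_ofReal
  have hpt : ∀ x, ‖W x - v‖ₑ ≤ ENNReal.ofReal d +
      (c * T.indicator (fun x => ENNReal.ofReal (growthBound n 1 1 x)) x +
        K * (microstates N U)ᶜ.indicator 1 x) := by
    intro x
    rw [← ofReal_norm, Real.norm_eq_abs]
    have hWv : |W x - v| ≤ growthBound n a b x + |v| :=
      (abs_sub _ _).trans (add_le_add (hC x) le_rfl)
    by_cases hxT : x ∈ T
    · refine le_add_left (le_add_right ?_)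
      rw [Set.indicator_of_mem hxT, ← ENNReal.ofReal_mul (by positivity)]
      exact ENNReal.ofReal_le_ofReal (hWv.trans (growthBound_le_mul n ha hb (abs_nonneg v) x))
    · have hxR : tupleNorm x ≤ R₀ := (not_le.1 hxT).le
      by_cases hxU : x ∈ microstates N U
      · exact le_add_right (ENNReal.ofReal_le_ofReal (hv x ⟨hxU, hxR.trans hR⟩))
      · refine le_add_left (le_add_left ?_)
        rw [Set.indicator_of_mem (Set.mem_compl hxU), Pi.one_apply, mul_one]
        exact ENNReal.ofReal_le_ofReal
          (hWv.trans (add_le_add (growthBound_le hn a hb hxR) le_rfl))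
  refine (lintegral_mono hpt).trans (le_of_eq ?_)
  rw [lintegral_add_left measurable_const,
    lintegral_add_left ((hg.indicator hT).const_mul _), lintegral_const_mul _ (hg.indicator hT),
    lintegral_const_mul _ (measurable_one.indicator hS), lintegral_indicator hT,
    lintegral_indicator_one hS]
  simp

theorem eventually_lintegral_potential_sub_le (hZ : ∀ N, partitionFn (V N) < ∞)
    (hA : ConcentratesAround (fun N => gibbsMeasure (V N)) l)
    (hn : 1 ≤ n) {a b : ℝ} (ha : 0 ≤ a) (hb : 0 ≤ b)
    (hC : ∀ N x, |V N x| ≤ growthBound n a b x)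
    (hD : Tendsto (fun N : ℕ+ => ∫⁻ x in {x : SATuple m N | R₀ ≤ tupleNorm x},
      ENNReal.ofReal (growthBound n 1 1 x) ∂gibbsMeasure (V N)) atTop (𝓝 0))
    {R : ℝ} (hR : R₀ ≤ R) {U : Set (NCLaw m)} (hU : IsOpen U) (hl : l ∈ U) {v d : ℝ} (hd : 0 < d)
    (hv : ∀ᶠ N : ℕ+ in atTop, ∀ x ∈ microstatesR N R U, |V N x - v| ≤ d) :
    ∀ᶠ N : ℕ+ in atTop, ∫⁻ x, ‖V N x - v‖ₑ ∂gibbsMeasure (V N) ≤ ENNReal.ofReal (2 * d) := by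
  have hlim := ((ENNReal.Tendsto.const_mul hD
    (.inr (ENNReal.ofReal_ne_top (r := a + b + |v|)))).add
    (ENNReal.Tendsto.const_mul (tendsto_measure_compl_microstates hZ hA hU hl)
      (.inr (ENNReal.ofReal_ne_top (r := a + b * (m * R₀ ^ (2 * n)) + |v|)))))
  rw [mul_zero, mul_zero, add_zero] at hlim
  filter_upwards [hv, eventually_partitionFn_ne_zero hA,
    hlim.eventually (gt_mem_nhds (ENNReal.ofReal_pos.2 hd))] with N hvN hN0 hN
  have := isProbabilityMeasure_gibbsMeasure (hZ N) hN0
  refine (lintegral_potential_sub_le hn ha hb (hC N) hR hU hvN _).trans ?_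
  rw [two_mul d, ENNReal.ofReal_add hd.le hd.le]
  exact add_le_add le_rfl hN.le

theorem integrable_and_abs_integral_sub_le {α : Type*} [MeasurableSpace α] {μ : Measure α}
    [IsProbabilityMeasure μ] {g : α → ℝ} (hg : Measurable g) {v c : ℝ} (hc : 0 ≤ c)
    (h : ∫⁻ x, ‖g x - v‖ₑ ∂μ ≤ ENNReal.ofReal c) :
    Integrable g μ ∧ |∫ x, g x ∂μ - v| ≤ c := by
  have hi : Integrable (fun x => g x - v) μ :=
    ⟨(hg.sub_const v).aestronglyMeasurable, h.trans_lt ENNReal.ofReal_lt_top⟩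
  have hig : Integrable g μ := by
    have := hi.add (integrable_const v)
    exact this.congr (ae_of_all _ fun x => sub_add_cancel _ _)
  refine ⟨hig, ?_⟩
  have he : ∫ x, g x ∂μ - v = ∫ x, (g x - v) ∂μ := by
    rw [integral_sub hig (integrable_const v)]
    simp
  rw [he, ← Real.norm_eq_abs, ← ENNReal.ofReal_le_ofReal_iff hc, ofReal_norm]
  exact (enorm_integral_le_lintegral_enorm _).trans h

/-- Microstate volumes and entropies of the Gibbs measures agree asymptotically. -/
theorem exists_eventually_normalizedLogVol_close (hVmeas : ∀ N, Measurable (V N))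
    (hZ : ∀ N, partitionFn (V N) < ∞)
    (hA : ConcentratesAround (fun N => gibbsMeasure (V N)) l)
    (hB : AsymptoticallyApproximable fun N x => (V N x : ℂ))
    (hn : 1 ≤ n) {a b : ℝ} (ha : 0 ≤ a) (hb : 0 ≤ b)
    (hC : ∀ N x, |V N x| ≤ growthBound n a b x) (hR₀ : 0 < R₀)
    (hD : Tendsto (fun N : ℕ+ => ∫⁻ x in {x : SATuple m N | R₀ ≤ tupleNorm x},
      ENNReal.ofReal (growthBound n 1 1 x) ∂gibbsMeasure (V N)) atTop (𝓝 0))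
    {R : ℝ} (hR : R₀ ≤ R) {d : ℝ} (hd : 0 < d) :
    ∃ U₀ : Set (NCLaw m), IsOpen U₀ ∧ l ∈ U₀ ∧ ∀ U ⊆ U₀, IsOpen U → l ∈ U →
      ∀ᶠ N : ℕ+ in atTop, Integrable (V N) (gibbsMeasure (V N)) ∧
        normalizedLogVol N R U ≤ normalizedEntropy (gibbsMeasure (V N)) + d ∧
        normalizedEntropy (gibbsMeasure (V N)) ≤ normalizedLogVol N R U + d := by
  -- The volume estimate and the mean of the potential each cost `2 * (d / 4)`.
  have hd4 : 0 < d / 4 := by positivity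
  obtain ⟨v, U₀, hU₀, hl₀, hv₀⟩ := exists_eventually_potential_close hB l hd4 (hR₀.trans_le hR)
  refine ⟨U₀, hU₀, hl₀, fun U hUU hU hl => ?_⟩
  have hv : ∀ᶠ N : ℕ+ in atTop, ∀ x ∈ microstatesR N R U, |V N x - v| ≤ d / 4 :=
    hv₀.mono fun N hN x hx => hN x ⟨hUU hx.1, hx.2⟩
  have hexp : ENNReal.ofReal (Real.exp (-(d / 4))) < 1 := by
    rw [← ENNReal.ofReal_one, ENNReal.ofReal_lt_ofReal_iff one_pos, Real.exp_lt_one_iff]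
    linarith
  filter_upwards [hv, eventually_partitionFn_ne_zero hA,
    eventually_le_measure_microstatesR hA hD hR (hU.mem_nhds hl) hexp,
    eventually_lintegral_potential_sub_le hZ hA hn ha hb hC hD hR hU hl hd4 hv]
    with N hvN hN0 hμN hIN
  have := isProbabilityMeasure_gibbsMeasure (hZ N) hN0
  obtain ⟨hint, hI⟩ := integrable_and_abs_integral_sub_le (hVmeas N) (by positivity) hIN
  obtain ⟨r, hr, hest⟩ := normalizedLog_volume_estimate (hZ N)
    (measurableSet_microstatesR N R hU) hvN hμN
  refine ⟨hint, ?_⟩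
  rw [normalizedEntropy_gibbsMeasure (hVmeas N) (hZ N) hN0 hint, normalizedLogVol, hr,
    ← EReal.coe_mul, ← EReal.coe_add, ← EReal.coe_add, ← EReal.coe_add, EReal.coe_le_coe_iff,
    EReal.coe_le_coe_iff]
  rw [abs_le] at hI hest
  constructor <;> linarith

end Concentration

/-- If normalized volumes and `u` agree asymptotically for small neighbourhoods and all large
cut-offs, then the microstates entropy built with the limit operation `Λ` equals `Λ u`. -/
theorem microstates_entropy_eq {m : ℕ} {l : NCLaw m} {u : ℕ+ → EReal} {R₀ : ℝ} (hR₀ : 0 < R₀)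
    (Λ : (ℕ+ → EReal) → EReal)
    (hΛ : ∀ {u w : ℕ+ → EReal} {d : ℝ}, (∀ᶠ N in atTop, u N ≤ w N + d) → Λ u ≤ Λ w + d)
    (h : ∀ R, R₀ ≤ R → ∀ d : ℝ, 0 < d → ∃ U₀ : Set (NCLaw m), IsOpen U₀ ∧ l ∈ U₀ ∧
      ∀ U ⊆ U₀, IsOpen U → l ∈ U → ∀ᶠ N : ℕ+ in atTop,
        normalizedLogVol N R U ≤ u N + d ∧ u N ≤ normalizedLogVol N R U + d) :
    (⨆ (R : ℝ) (_ : 0 < R), ⨅ (U : Set (NCLaw m)) (_ : IsOpen U) (_ : l ∈ U),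
        Λ fun N : ℕ+ => normalizedLogVol N R U) =
      (⨅ (U : Set (NCLaw m)) (_ : IsOpen U) (_ : l ∈ U),
        Λ fun N : ℕ+ => normalizedLogVol N R₀ U) ∧
    (⨅ (U : Set (NCLaw m)) (_ : IsOpen U) (_ : l ∈ U),
        Λ fun N : ℕ+ => normalizedLogVol N R₀ U) = Λ u := by
  have hmono : ∀ {R S : ℝ} {U W : Set (NCLaw m)}, R ≤ S → U ⊆ W →
      (Λ fun N : ℕ+ => normalizedLogVol N R U) ≤ Λ fun N : ℕ+ => normalizedLogVol N S W := by
    intro R S U W hRS hUW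
    -- Monotonicity of `Λ` is its shift property with `d = 0`.
    have := hΛ (u := fun N : ℕ+ => normalizedLogVol N R U)
      (w := fun N : ℕ+ => normalizedLogVol N S W) (d := 0)
      (Eventually.of_forall fun N => by simpa using normalizedLogVol_mono N hRS hUW)
    simpa using this
  have key : ∀ R, R₀ ≤ R → (⨅ (U : Set (NCLaw m)) (_ : IsOpen U) (_ : l ∈ U),
      Λ fun N : ℕ+ => normalizedLogVol N R U) = Λ u := by
    intro R hR
    apply le_antisymm
    · refine ereal_le_of_forall_pos_le_add fun d hd => ?_
      obtain ⟨U₀, hU₀, hl₀, hev⟩ := h R hR d hd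
      exact (iInf_le_of_le U₀ (iInf₂_le hU₀ hl₀)).trans
        (hΛ ((hev U₀ subset_rfl hU₀ hl₀).mono fun N hN => hN.1))
    · refine le_iInf fun U => le_iInf fun hU => le_iInf fun hl => ?_
      refine ereal_le_of_forall_pos_le_add fun d hd => ?_
      obtain ⟨U₀, hU₀, hl₀, hev⟩ := h R hR d hd
      -- An arbitrary neighbourhood is first shrunk into `U₀`, where the comparison holds, then
      -- enlarged back by monotonicity.
      exact (hΛ ((hev (U ∩ U₀) Set.inter_subset_right (hU.inter hU₀) ⟨hl, hl₀⟩).mono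
        fun N hN => hN.2)).trans (add_le_add (hmono le_rfl Set.inter_subset_left) le_rfl)
  refine ⟨le_antisymm (iSup₂_le fun R _ => ?_) (le_iSup₂_of_le R₀ hR₀ le_rfl), key R₀ le_rfl⟩
  -- A cut-off below `R₀` is raised to `max R R₀`, which can only increase the value.
  rw [key R₀ le_rfl, ← key (max R R₀) (le_max_right _ _)]
  exact iInf_mono fun U => iInf₂_mono fun _ _ => hmono (le_max_left _ _) subset_rfl

/-! ### The involution on non-commutative polynomials -/

section Star

variable {m : ℕ}

/-- The `j`-th variable. -/
def ncVar (j : Fin m) : NCPoly m := MonoidAlgebra.single (FreeMonoid.of j) 1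

theorem ncStar_single (w : FreeMonoid (Fin m)) (c : ℂ) :
    ncStar (MonoidAlgebra.single w c : NCPoly m) = MonoidAlgebra.single w.reverse (star c) := by
  simp [ncStar, MonoidAlgebra.single_zero]

theorem ncStar_zero : ncStar (0 : NCPoly m) = 0 := by simp [ncStar]

theorem ncStar_add (p q : NCPoly m) : ncStar (p + q) = ncStar p + ncStar q := by
  classical
  simp only [ncStar, MonoidAlgebra.coeff_add]
  exact Finsupp.sum_add_index (by simp) (by simp [MonoidAlgebra.single_add])

theorem ncStar_smul (c : ℂ) (p : NCPoly m) : ncStar (c • p) = star c • ncStar p := by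
  induction p using MonoidAlgebra.induction_linear with
  | zero => simp [ncStar_zero]
  | add p q hp hq => rw [smul_add, ncStar_add, ncStar_add, hp, hq, smul_add]
  | single w d => simp [ncStar_single, MonoidAlgebra.smul_single]

theorem ncStar_one : ncStar (1 : NCPoly m) = 1 := by
  rw [MonoidAlgebra.one_def, ncStar_single, star_one]
  rfl

theorem ncStar_var (j : Fin m) : ncStar (ncVar j) = ncVar j := by
  rw [ncVar, ncStar_single, star_one, FreeMonoid.reverse_of]

theorem ncStar_ncStar (p : NCPoly m) : ncStar (ncStar p) = p := by
  induction p using MonoidAlgebra.induction_linear with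
  | zero => simp [ncStar_zero]
  | add p q hp hq => rw [ncStar_add, ncStar_add, hp, hq]
  | single w d => simp [ncStar_single]

theorem ncStar_mul (p q : NCPoly m) : ncStar (p * q) = ncStar q * ncStar p := by
  induction p using MonoidAlgebra.induction_linear with
  | zero => simp [ncStar_zero]
  | add p p' hp hp' => rw [add_mul, ncStar_add, ncStar_add, hp, hp', mul_add]
  | single w c =>
    induction q using MonoidAlgebra.induction_linear with
    | zero => simp [ncStar_zero]
    | add q q' hq hq' => rw [mul_add, ncStar_add, ncStar_add, hq, hq', add_mul]
    | single v d =>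
      rw [MonoidAlgebra.single_mul_single, ncStar_single, ncStar_single, ncStar_single,
        MonoidAlgebra.single_mul_single, FreeMonoid.reverse_mul, star_mul]

theorem ncEval_var {A : Type*} [Ring A] [Algebra ℂ A] (x : Fin m → A) (j : Fin m) :
    ncEval x (ncVar j) = x j := by
  simp [ncEval, ncVar]

theorem map_ncEval {A B : Type*} [Ring A] [Algebra ℂ A] [Ring B] [Algebra ℂ B] (φ : A →ₐ[ℂ] B)
    (x : Fin m → A) (p : NCPoly m) : φ (ncEval x p) = ncEval (fun j => φ (x j)) p := by
  have hw : ∀ w, φ (FreeMonoid.lift x w) = FreeMonoid.lift (fun j => φ (x j)) w := by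
    intro w
    induction w using FreeMonoid.inductionOn' with
    | one => simp
    | of_mul a w ih => simp [ih]
  simp [ncEval, MonoidAlgebra.lift_apply, Finsupp.sum, hw]

/-- Induction on polynomials by multiplying with a variable on the left. -/
theorem ncPoly_induction {motive : NCPoly m → Prop} (p : NCPoly m) (one : motive 1)
    (var_mul : ∀ j q, motive q → motive (ncVar j * q))
    (add : ∀ q r, motive q → motive r → motive (q + r))
    (smul : ∀ (c : ℂ) q, motive q → motive (c • q)) : motive p := by
  induction p using MonoidAlgebra.induction_linear with
  | zero => simpa using smul 0 1 one
  | add p q hp hq => exact add p q hp hq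
  | single w c =>
    have h : (MonoidAlgebra.single w c : NCPoly m) = c • MonoidAlgebra.single w 1 := by
      simp [MonoidAlgebra.smul_single]
    rw [h]
    apply smul
    induction w using FreeMonoid.inductionOn' with
    | one => exact one
    | of_mul a w ih =>
      have : (MonoidAlgebra.single (FreeMonoid.of a * w) 1 : NCPoly m) =
          ncVar a * MonoidAlgebra.single w 1 := by
        rw [ncVar, MonoidAlgebra.single_mul_single, one_mul]
      rw [this]
      exact var_mul a _ (ih (by simp [MonoidAlgebra.smul_single]))

theorem NCLaw.nonneg (l : NCLaw m) (p : NCPoly m) : 0 ≤ l.toLinearMap (ncStar p * p) := by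
  have h := (l.completelyPositive 1 1 (Matrix.of fun _ _ => p)).diag_nonneg (i := 0)
  simpa [Matrix.mul_apply, ncAdjoint] using h

/-- Complete positivity for the row `(1, p)` gives a Hermitian Gram matrix whose off-diagonal
entries are `l(p)` and `l(p*)`. -/
theorem NCLaw.map_ncStar (l : NCLaw m) (p : NCPoly m) :
    l.toLinearMap (ncStar p) = star (l.toLinearMap p) := by
  have h := (l.completelyPositive 1 2 (Matrix.of fun _ j => if j = 0 then 1 else p)).isHermitian
  have h01 := h.apply 1 0
  simpa [Matrix.mul_apply, ncAdjoint, ncStar_one] using h01.symm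

end Star

/-! ### The Gelfand–Naimark–Segal representation of a bounded law -/

section GNS

variable {m : ℕ} (l : NCLaw m)

/-- `ℂ⟨X₁, …, X_m⟩` with the semi-inner product `⟪p, q⟫ = l(p* q)`. -/
def PreGNS (_l : NCLaw m) : Type := NCPoly m

instance : AddCommGroup (PreGNS l) := inferInstanceAs (AddCommGroup (NCPoly m))
instance : Module ℂ (PreGNS l) := inferInstanceAs (Module ℂ (NCPoly m))

/-- The identity map onto the pre-Hilbert space of a law. -/
def toPreGNS : NCPoly m ≃ₗ[ℂ] PreGNS l := LinearEquiv.refl ℂ _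

/-- The semi-inner product given by a law. -/
abbrev preGNSCore : PreInnerProductSpace.Core ℂ (PreGNS l) where
  inner p q := l.toLinearMap (ncStar ((toPreGNS l).symm p) * (toPreGNS l).symm q)
  conj_inner_symm p q := by
    rw [starRingEnd_apply, ← l.map_ncStar, ncStar_mul, ncStar_ncStar]
  re_inner_nonneg p := (Complex.le_def.1 (l.nonneg _)).1
  add_left p q r := by rw [map_add, ncStar_add, add_mul, map_add]
  smul_left p q c := by
    rw [map_smul, ncStar_smul, smul_mul_assoc, map_smul, smul_eq_mul, starRingEnd_apply]

instance : SeminormedAddCommGroup (PreGNS l) :=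
  InnerProductSpace.Core.toSeminormedAddCommGroup (c := preGNSCore l)

instance : InnerProductSpace ℂ (PreGNS l) := InnerProductSpace.ofCore (preGNSCore l)

/-- The Hilbert space of a law. -/
abbrev GNSSpace : Type := UniformSpace.Completion (PreGNS l)

/-- The vector of a polynomial in the Hilbert space of a law. -/
def gnsVec (p : NCPoly m) : GNSSpace l := ((toPreGNS l p : PreGNS l) : GNSSpace l)

theorem inner_gnsVec (p q : NCPoly m) :
    inner ℂ (gnsVec l p) (gnsVec l q) = l.toLinearMap (ncStar p * q) :=
  UniformSpace.Completion.inner_coe _ _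

theorem gnsVec_add (p q : NCPoly m) : gnsVec l (p + q) = gnsVec l p + gnsVec l q := by
  rw [gnsVec, map_add, UniformSpace.Completion.coe_add]
  rfl

theorem gnsVec_smul (c : ℂ) (p : NCPoly m) : gnsVec l (c • p) = c • gnsVec l p := by
  rw [gnsVec, map_smul, UniformSpace.Completion.coe_smul]
  rfl

theorem denseRange_gnsVec : DenseRange (gnsVec l) :=
  UniformSpace.Completion.denseRange_coe (α := PreGNS l)

theorem norm_gnsVec_sq (p : NCPoly m) : ‖gnsVec l p‖ ^ 2 = (l.toLinearMap (ncStar p * p)).re := by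
  rw [← inner_gnsVec, ← inner_self_eq_norm_sq (𝕜 := ℂ)]
  rfl

/-- This is where traciality enters the norm. The isometric involution carries bounds on left
multiplication to right multiplication and later exchanges `T Ω` with `T* Ω`. -/
theorem norm_gnsVec_ncStar (p : NCPoly m) : ‖gnsVec l (ncStar p)‖ = ‖gnsVec l p‖ := by
  rw [← sq_eq_sq₀ (norm_nonneg _) (norm_nonneg _), norm_gnsVec_sq, norm_gnsVec_sq, ncStar_ncStar,
    l.tracial]

/-- A law is bounded by `R` if multiplication by each variable is bounded by `R` for its
semi-norm. -/
def NCLaw.BoundedBy (l : NCLaw m) (R : ℝ) : Prop :=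
  ∀ j p, (l.toLinearMap (ncStar (ncVar j * p) * (ncVar j * p))).re ≤
    R ^ 2 * (l.toLinearMap (ncStar p * p)).re

variable {l}

theorem exists_gnsOp {R : ℝ} (hR : 0 ≤ R) (T : NCPoly m →ₗ[ℂ] NCPoly m)
    (hT : ∀ p, ‖gnsVec l (T p)‖ ≤ R * ‖gnsVec l p‖)
    (hs : ∀ p q, l.toLinearMap (ncStar (T p) * q) = l.toLinearMap (ncStar p * T q)) :
    ∃ A : GNSSpace l →L[ℂ] GNSSpace l, (∀ p, A (gnsVec l p) = gnsVec l (T p)) ∧ ‖A‖ ≤ R ∧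
      IsSelfAdjoint A := by
  let B : PreGNS l →L[ℂ] PreGNS l :=
    ((toPreGNS l).toLinearMap ∘ₗ T ∘ₗ (toPreGNS l).symm.toLinearMap).mkContinuous R fun p => by
      have := hT ((toPreGNS l).symm p)
      rwa [gnsVec, gnsVec, UniformSpace.Completion.norm_coe, UniformSpace.Completion.norm_coe]
        at this
  have hA : ∀ p, B.completion (gnsVec l p) = gnsVec l (T p) := fun p =>
    B.completion_apply_coe _
  refine ⟨B.completion, hA, ?_, ?_⟩
  · refine ContinuousLinearMap.opNorm_le_bound _ hR fun v => ?_
    refine (denseRange_gnsVec l).induction_on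
      (p := fun v => ‖B.completion v‖ ≤ R * ‖v‖) v ?_ fun p => ?_
    · exact isClosed_le (by fun_prop) (by fun_prop)
    · rw [hA]
      exact hT p
  · rw [ContinuousLinearMap.isSelfAdjoint_iff_isSymmetric]
    intro v w
    change inner ℂ (B.completion v) w = inner ℂ v (B.completion w)
    refine (denseRange_gnsVec l).induction_on₂
      (p := fun v w => inner ℂ (B.completion v) w = inner ℂ v (B.completion w)) ?_ ?_ v w
    · exact isClosed_eq (by fun_prop) (by fun_prop)
    · intro p q
      rw [hA, hA, inner_gnsVec, inner_gnsVec, hs]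

theorem exists_left_mul {R : ℝ} (hR : 0 ≤ R) (hl : l.BoundedBy R) (j : Fin m) :
    ∃ A : GNSSpace l →L[ℂ] GNSSpace l, (∀ p, A (gnsVec l p) = gnsVec l (ncVar j * p)) ∧ ‖A‖ ≤ R ∧
      IsSelfAdjoint A := by
  refine exists_gnsOp hR (LinearMap.mulLeft ℂ (ncVar j)) (fun p => ?_) fun p q => ?_
  · rw [← sq_le_sq₀ (norm_nonneg _) (by positivity), mul_pow, norm_gnsVec_sq, norm_gnsVec_sq]
    exact hl j p
  · simp only [LinearMap.mulLeft_apply, ncStar_mul, ncStar_var, mul_assoc]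

/-- Right multiplication is left multiplication conjugated by the isometric involution; its
self-adjointness uses traciality. -/
theorem exists_right_mul {R : ℝ} (hR : 0 ≤ R) (hl : l.BoundedBy R) (j : Fin m) :
    ∃ A : GNSSpace l →L[ℂ] GNSSpace l, (∀ p, A (gnsVec l p) = gnsVec l (p * ncVar j)) ∧ ‖A‖ ≤ R ∧
      IsSelfAdjoint A := by
  refine exists_gnsOp hR (LinearMap.mulRight ℂ (ncVar j)) (fun p => ?_) fun p q => ?_
  · rw [LinearMap.mulRight_apply, ← norm_gnsVec_ncStar, ← norm_gnsVec_ncStar l p, ncStar_mul,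
      ncStar_var, ← sq_le_sq₀ (norm_nonneg _) (by positivity), mul_pow, norm_gnsVec_sq,
      norm_gnsVec_sq]
    exact hl j _
  · simp only [LinearMap.mulRight_apply, ncStar_mul, ncStar_var]
    rw [mul_assoc, l.tracial, mul_assoc]

end GNS

/-! ### Traces from cyclic vectors -/

section Trace

variable {H : Type*} [NormedAddCommGroup H] [InnerProductSpace ℂ H] [CompleteSpace H]

open ContinuousLinearMap in
/-- If a dense family `e i`, together with a norm-preserving conjugate family `e' i`, exchanges
`T* Ω` with `T Ω` for all `T` in a self-adjoint set, then the vector state of `Ω` is tracial on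
this set. -/
theorem inner_mul_comm_of_denseRange {ι : Type*} {e e' : ι → H} (he : DenseRange e)
    (he' : DenseRange e') (hnorm : ∀ i, ‖e' i‖ = ‖e i‖) {Ω : H} {s : Set (H →L[ℂ] H)}
    (hs : ∀ T ∈ s, star T ∈ s)
    (hconj : ∀ T ∈ s, ∀ i, inner ℂ Ω (T (e i)) = inner ℂ (e' i) (T Ω))
    {S T : H →L[ℂ] H} (hS : S ∈ s) (hT : T ∈ s) :
    inner ℂ Ω (T (S Ω)) = inner ℂ Ω (S (T Ω)) := by
  have hconj' : ∀ T ∈ s, ∀ i, inner ℂ (star T Ω) (e i) = inner ℂ (e' i) (T Ω) := by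
    intro T hT i
    rw [star_eq_adjoint, adjoint_inner_left]
    exact hconj T hT i
  -- By duality: pairing `T Ω` with the dense vectors `e' i` is pairing `T* Ω` with vectors of the
  -- same norm.
  have hle : ∀ T ∈ s, ‖T Ω‖ ≤ ‖star T Ω‖ := by
    intro T hT
    have h : ∀ v, ‖inner ℂ v (T Ω)‖ ≤ ‖v‖ * ‖star T Ω‖ := by
      intro v
      refine he'.induction_on (p := fun v => ‖inner ℂ v (T Ω)‖ ≤ ‖v‖ * ‖star T Ω‖) v ?_ fun i => ?_
      · exact isClosed_le (by fun_prop) (by fun_prop)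
      · rw [← hconj' T hT, hnorm, mul_comm]
        exact norm_inner_le_norm _ _
    have h2 := h (T Ω)
    rw [inner_self_eq_norm_sq_to_K, norm_pow, RCLike.norm_ofReal, abs_norm, sq] at h2
    rcases (norm_nonneg (T Ω)).eq_or_lt with h0 | h0
    · rw [← h0]
      exact norm_nonneg _
    · exact le_of_mul_le_mul_left h2 h0
  have heq : ‖star S Ω‖ = ‖S Ω‖ := by
    refine le_antisymm ?_ (hle S hS)
    simpa using hle (star S) (hs S hS)
  -- Equal norms and equal real inner products give equal distances, so when `e i` tends to `S Ω`,
  -- `e' i` tends to `S* Ω`. No antiunitary conjugation has to be constructed.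
  have hdist : ∀ i, ‖e' i - star S Ω‖ = ‖e i - S Ω‖ := by
    intro i
    rw [← sq_eq_sq₀ (norm_nonneg _) (norm_nonneg _), norm_sub_sq (𝕜 := ℂ), norm_sub_sq (𝕜 := ℂ),
      hnorm, heq]
    have := hconj' (star S) (hs S hS) i
    rw [star_star] at this
    rw [← this, inner_re_symm]
  obtain ⟨u, hu, hlim⟩ := mem_closure_iff_seq_limit.1 (he (S Ω))
  choose k hk using hu
  have hlim' : Tendsto (fun n => e' (k n)) atTop (𝓝 (star S Ω)) := by
    rw [tendsto_iff_norm_sub_tendsto_zero] at hlim ⊢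
    simpa [hdist, hk] using hlim
  have h1 : Tendsto (fun n => inner ℂ (star T Ω) (e (k n))) atTop
      (𝓝 (inner ℂ (star T Ω) (S Ω))) := by
    simp only [hk]
    exact tendsto_const_nhds.inner hlim
  have h2 : Tendsto (fun n => inner ℂ (star T Ω) (e (k n))) atTop
      (𝓝 (inner ℂ (star S Ω) (T Ω))) := by
    simp only [hconj' T hT]
    exact hlim'.inner tendsto_const_nhds
  have := tendsto_nhds_unique h1 h2
  rwa [star_eq_adjoint, star_eq_adjoint, adjoint_inner_left, adjoint_inner_left] at this

/-- The commutant of a set of operators and of their adjoints. -/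
def commutantAlgebra (s : Set (H →L[ℂ] H)) : VonNeumannAlgebra H where
  toStarSubalgebra := StarSubalgebra.centralizer ℂ s
  centralizer_centralizer' := Set.centralizer_centralizer_centralizer _

/-- The vector state `T ↦ ⟪Ω, T Ω⟫` as a trace on a von Neumann algebra on which it is tracial. -/
def tracialOfVector (M : VonNeumannAlgebra H) (Ω : H) (hΩ : ‖Ω‖ = 1)
    (h : ∀ S ∈ M, ∀ T ∈ M, inner ℂ Ω (S (T Ω)) = inner ℂ Ω (T (S Ω))) :
    TracialVonNeumannAlgebra H where
  algebra := M
  trace :=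
    { toFun := fun T => inner ℂ Ω ((T : H →L[ℂ] H) Ω)
      map_add' := fun S T => by
        rw [← inner_add_right]
        rfl
      map_smul' := fun c T => by
        rw [RingHom.id_apply, smul_eq_mul, ← inner_smul_right]
        rfl
      cont := by fun_prop }
  continuous_wot := by
    have hc : Continuous fun T : H →WOT[ℂ] H => inner ℂ Ω (T Ω) := by fun_prop
    exact @Continuous.comp M.toStarSubalgebra (H →WOT[ℂ] H) ℂ (TopologicalSpace.induced _ _) _ _
      (fun T => ContinuousLinearMapWOT.ofCLM (T : H →L[ℂ] H)) _ hc continuous_induced_dom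
  trace_one := by
    change inner ℂ Ω Ω = 1
    rw [inner_self_eq_norm_sq_to_K, hΩ]
    simp
  trace_mul_comm S T := h S S.2 T T.2
  trace_star_mul_self T := by
    change 0 ≤ inner ℂ Ω (star (T : H →L[ℂ] H) ((T : H →L[ℂ] H) Ω))
    rw [ContinuousLinearMap.star_eq_adjoint, ContinuousLinearMap.adjoint_inner_right,
      inner_self_eq_norm_sq_to_K, ← RCLike.ofReal_pow]
    exact Complex.zero_le_real.2 (sq_nonneg _)

end Trace

/-- A bounded law is the law of a tuple in a tracial von Neumann algebra: the commutant of the right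
multiplications in the Gelfand–Naimark–Segal representation. -/
theorem NCLaw.BoundedBy.isRealizable {m : ℕ} {l : NCLaw m} {R : ℝ} (hR : 0 ≤ R)
    (hl : l.BoundedBy R) : l.IsRealizable R := by
  choose A hA hAnorm hAsa using exists_left_mul hR hl
  choose B hB _ hBsa using exists_right_mul hR hl
  set M := commutantAlgebra (Set.range B) with hM
  have hmem : ∀ T : GNSSpace l →L[ℂ] GNSSpace l, T ∈ M ↔ ∀ j, B j * T = T * B j := by
    intro T
    change T ∈ StarSubalgebra.centralizer ℂ (Set.range B) ↔ _
    rw [StarSubalgebra.mem_centralizer_iff, Set.forall_mem_range]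
    simp only [fun j => (hBsa j).star_eq, and_self]
  have hAM : ∀ j, A j ∈ M := by
    intro j
    rw [hmem]
    intro k
    ext v
    refine (denseRange_gnsVec l).induction_on
      (p := fun v => (B k * A j) v = (A j * B k) v) v ?_ fun p => ?_
    · exact isClosed_eq (by fun_prop) (by fun_prop)
    · rw [mul_apply_eq_comp, mul_apply_eq_comp, hA, hB, hB, hA, mul_assoc]
  -- Commutation with the right multiplications moves `p` across the inner product. The case `q = r
  -- = 1` is the exchange relation needed for the trace; general `q` and `r` keep the induction
  -- going.
  have hright : ∀ T ∈ M, ∀ p q r,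
      inner ℂ (gnsVec l q) (T (gnsVec l (r * p))) =
        inner ℂ (gnsVec l (q * ncStar p)) (T (gnsVec l r)) := by
    intro T hT p
    induction p using ncPoly_induction with
    | one => simp [ncStar_one]
    | var_mul j p ih =>
      intro q r
      have hc : T (gnsVec l (r * ncVar j)) = B j (T (gnsVec l r)) := by
        rw [← hB]
        exact (congrArg (fun S => S (gnsVec l r)) ((hmem T).1 hT j)).symm
      rw [← mul_assoc, ih, hc, ncStar_mul, ncStar_var, ← mul_assoc, ← hB]
      conv_rhs => rw [← (hBsa j).star_eq]
      rw [ContinuousLinearMap.star_eq_adjoint, ContinuousLinearMap.adjoint_inner_left]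
    | add p p' hp hp' =>
      intro q r
      rw [mul_add, gnsVec_add, map_add, inner_add_right, hp, hp', ncStar_add, mul_add, gnsVec_add,
        inner_add_left]
    | smul c p hp =>
      intro q r
      rw [mul_smul_comm, gnsVec_smul, map_smul, inner_smul_right, hp, ncStar_smul, mul_smul_comm,
        gnsVec_smul, inner_smul_left, starRingEnd_apply, star_star]
  have hΩ : ‖gnsVec l 1‖ = 1 := by
    rw [← sq_eq_sq₀ (norm_nonneg _) zero_le_one, norm_gnsVec_sq, ncStar_one, one_mul, l.unital]
    simp
  have hstarsurj : Function.Surjective (ncStar (m := m)) := fun p => ⟨_, ncStar_ncStar p⟩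
  have htr : ∀ S ∈ M, ∀ T ∈ M, inner ℂ (gnsVec l 1) (S (T (gnsVec l 1))) =
      inner ℂ (gnsVec l 1) (T (S (gnsVec l 1))) := by
    intro S hS T hT
    refine inner_mul_comm_of_denseRange (e := gnsVec l) (e' := fun p => gnsVec l (ncStar p))
      (s := (M : Set (GNSSpace l →L[ℂ] GNSSpace l))) (denseRange_gnsVec l) ?_
      (norm_gnsVec_ncStar l) (fun T hT => star_mem hT) ?_ hT hS
    · rw [DenseRange, Set.range_comp' (gnsVec l) ncStar, hstarsurj.range_eq, Set.image_univ]
      exact denseRange_gnsVec l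
    · intro T hT p
      simpa using hright T hT p 1 1
  have heval : ∀ p q, ncEval A p (gnsVec l q) = gnsVec l (p * q) := by
    intro p
    induction p using ncPoly_induction with
    | one => simp
    | var_mul j p ih =>
      intro q
      rw [map_mul, ncEval_var, mul_apply_eq_comp, ih, hA, mul_assoc]
    | add p p' hp hp' =>
      intro q
      rw [map_add, add_apply, hp, hp', add_mul, gnsVec_add]
    | smul c p hp =>
      intro q
      rw [map_smul, smul_apply, hp, smul_mul_assoc, gnsVec_smul]
  refine ⟨GNSSpace l, inferInstance, inferInstance, inferInstance,
    tracialOfVector M (gnsVec l 1) hΩ htr, fun j => ⟨A j, hAM j⟩, fun j => Subtype.ext (hAsa j),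
    hAnorm, fun p => ?_⟩
  have hcoe : M.toStarSubalgebra.subtype.toAlgHom
      (ncEval (fun j => (⟨A j, hAM j⟩ : M.toStarSubalgebra)) p) = ncEval A p :=
    map_ncEval _ _ _
  change _ = inner ℂ (gnsVec l 1) (M.toStarSubalgebra.subtype.toAlgHom
      (ncEval (fun j => (⟨A j, hAM j⟩ : M.toStarSubalgebra)) p) (gnsVec l 1))
  rw [hcoe, heval, mul_one, inner_gnsVec, ncStar_one, one_mul]

/-! ### Boundedness of the limit law -/

theorem matrixLaw_boundedBy {m N : ℕ} [NeZero N] {x : SATuple m N} {R : ℝ} (hx : tupleNorm x ≤ R) :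
    (matrixLaw x).BoundedBy R := by
  intro j p
  have h := re_ntrace_mul_le (x.mat j) (ncEval x.mat p) ((matOpNorm_le_tupleNorm x j).trans hx)
  simpa only [matrixLaw, LinearMap.comp_apply, AlgHom.toLinearMap_apply, map_mul, ncEval_ncStar,
    ncEval_var] using h

/-- Boundedness is a closed condition on laws. -/
theorem isClosed_boundedBy (m : ℕ) (R : ℝ) : IsClosed {l : NCLaw m | l.BoundedBy R} := by
  simp only [NCLaw.BoundedBy, Set.ofPred_forall]
  exact isClosed_iInter fun j => isClosed_iInter fun p =>
    isClosed_le (Complex.continuous_re.comp (continuous_apply_law _))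
      (continuous_const.mul (Complex.continuous_re.comp (continuous_apply_law _)))

/-- Each neighbourhood of `l` has cut-off microstates of positive mass for some `N`, hence contains
the law of a matrix tuple of norm at most `R₀`; thus `l` lies in the closure of a closed set. -/
theorem boundedBy_of_concentrates {m : ℕ} {V : ∀ N : ℕ+, SATuple m N → ℝ} {l : NCLaw m} {n : ℕ}
    {R₀ : ℝ} (hA : ConcentratesAround (fun N => gibbsMeasure (V N)) l)
    (hD : Tendsto (fun N : ℕ+ => ∫⁻ x in {x : SATuple m N | R₀ ≤ tupleNorm x},
      ENNReal.ofReal (growthBound n 1 1 x) ∂gibbsMeasure (V N)) atTop (𝓝 0)) :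
    l.BoundedBy R₀ := by
  rw [← Set.mem_ofPred_eq (p := fun l : NCLaw m => l.BoundedBy R₀),
    ← (isClosed_boundedBy m R₀).closure_eq, mem_closure_iff_nhds]
  intro U hU
  obtain ⟨N, hN⟩ := (eventually_le_measure_microstatesR hA hD le_rfl hU
    (ENNReal.half_lt_self one_ne_zero ENNReal.one_ne_top)).exists
  have hne : gibbsMeasure (V N) (microstatesR N R₀ U) ≠ 0 := by
    intro h
    simp [h] at hN
  obtain ⟨x, hx⟩ := nonempty_of_measure_ne_zero hne
  exact ⟨matrixLaw x, hx.1, matrixLaw_boundedBy hx.2⟩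

end FreeEntropy

end

theorem mainTheorem6 {m : ℕ} (hm : 1 ≤ m)
    (V : ∀ N : ℕ+, FreeEntropy.SATuple m N → ℝ)
    (hVmeas : ∀ N, Measurable (V N))
    (hZ : ∀ N, FreeEntropy.partitionFn (V N) < ∞)
    (l : FreeEntropy.NCLaw m)
    (hA : FreeEntropy.ConcentratesAround (fun N => FreeEntropy.gibbsMeasure (V N)) l)
    (hB : FreeEntropy.AsymptoticallyApproximable fun N x => (V N x : ℂ))
    (n : ℕ) (hn : 1 ≤ n) (a b : ℝ) (ha : 0 < a) (hb : 0 < b)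
    (hC : ∀ N x, |V N x| ≤ FreeEntropy.growthBound n a b x)
    (R₀ : ℝ) (hR₀ : 0 < R₀)
    (hD : Tendsto (fun N : ℕ+ =>
        ∫⁻ x in {x : FreeEntropy.SATuple m N | R₀ ≤ FreeEntropy.tupleNorm x},
          ENNReal.ofReal (FreeEntropy.growthBound n 1 1 x) ∂FreeEntropy.gibbsMeasure (V N))
      atTop (𝓝 0)) :
    l.IsRealizable R₀ ∧
    (∀ᶠ N : ℕ+ in atTop, Integrable
      (fun x => Real.negMulLog (FreeEntropy.density (FreeEntropy.gibbsMeasure (V N)) x))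
      (FreeEntropy.lebesgueSA m N)) ∧
    (FreeEntropy.chi l = FreeEntropy.chiR R₀ l ∧
      FreeEntropy.chiR R₀ l = limsup (fun N : ℕ+ =>
        FreeEntropy.normalizedEntropy (FreeEntropy.gibbsMeasure (V N))) atTop) ∧
    (FreeEntropy.chiLower l = FreeEntropy.chiLowerR R₀ l ∧
      FreeEntropy.chiLowerR R₀ l = liminf (fun N : ℕ+ =>
        FreeEntropy.normalizedEntropy (FreeEntropy.gibbsMeasure (V N))) atTop) := by
  have hclose := fun R (hR : R₀ ≤ R) (d : ℝ) (hd : 0 < d) =>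
    FreeEntropy.exists_eventually_normalizedLogVol_close hVmeas hZ hA hB hn ha.le hb.le hC hR₀ hD
      hR hd
  have hclose' : ∀ R, R₀ ≤ R → ∀ d : ℝ, 0 < d → ∃ U₀ : Set (FreeEntropy.NCLaw m),
      IsOpen U₀ ∧ l ∈ U₀ ∧ ∀ U ⊆ U₀, IsOpen U → l ∈ U → ∀ᶠ N : ℕ+ in atTop,
        FreeEntropy.normalizedLogVol N R U ≤
          FreeEntropy.normalizedEntropy (FreeEntropy.gibbsMeasure (V N)) + d ∧
        FreeEntropy.normalizedEntropy (FreeEntropy.gibbsMeasure (V N)) ≤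
          FreeEntropy.normalizedLogVol N R U + d := by
    intro R hR d hd
    obtain ⟨U₀, hU₀, hl₀, h⟩ := hclose R hR d hd
    exact ⟨U₀, hU₀, hl₀, fun U hUU hU hl => (h U hUU hU hl).mono fun N hN => hN.2⟩
  refine ⟨(FreeEntropy.boundedBy_of_concentrates hA hD).isRealizable hR₀.le, ?_,
    FreeEntropy.microstates_entropy_eq hR₀ (fun u => limsup u atTop)
      FreeEntropy.limsup_le_limsup_add_coe hclose',
    FreeEntropy.microstates_entropy_eq hR₀ (fun u => liminf u atTop)
      FreeEntropy.liminf_le_liminf_add_coe hclose'⟩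
  -- Only integrability of `V_N` is wanted here, so the tolerance `1` is arbitrary.
  obtain ⟨U₀, hU₀, hl₀, h⟩ := hclose R₀ le_rfl 1 one_pos
  filter_upwards [h U₀ subset_rfl hU₀ hl₀, FreeEntropy.eventually_partitionFn_ne_zero hA]
    with N hN hN0
  exact (FreeEntropy.integrable_negMulLog_density (hVmeas N) (hZ N) hN0 hN.1).1
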